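/- **Theorem 2.** Let $p$ be a prime, $n\ge 1$, $d=p^n$, $\omega=e^{2\pi i/p}$, and let $X^{q}Z^{s}:|j\rangle\mapsto\omega^{s\cdot j}|j+q\rangle$ ($q,s\in(\mathbb Z/p)^n$) be the generalized Pauli operators on $(\mathbb C^p)^{\otimes n}$. The Pauli group consists of the operators $c\,X^qZ^s$ with $c^4=1$ if $p=2$ and $c^p=1$ if $p$ is odd; the Clifford group is the group of unitaries that map Pauli operators to Pauli operators under conjugation. A *complete set of Pauli MUB* is the set of $d+1$ bases obtained from a partition of the $d^2-1$ non-identity Pauli operators (modulo phases) into $d+1$ sets of $d-1$ mutually commuting operators, each basis consisting of the joint eigenstates of one of the sets (basis states are considered up to phase). (a) Let $U$ be a unitary that maps a complete set of Pauli MUB $B_1$ onto a complete set of Pauli MUB $B_2$. Then, up to a global phase, $U$ is in the Clifford group. (b) Fix a complete set of Pauli MUB $B$ and let $F$ be the field with $d$ elements. A *quantum net* matches the $d+1$ striations (classes of parallel lines) of $F\times F$ with the bases of $B$, and the lines of each striation bijectively with the projectors $P_l$ onto the states of its basis. It defines the Wigner function $W_\alpha(\rho)=\operatorname{Tr}(\rho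 A(\alpha))$ with $A(\alpha)=\frac1d\big(\sum_{l\ni\alpha}P_l-1\big)$, where $l$ ranges over the lines through $\alpha\in F\times F$. Let $C_d$ be the set of density matrices $\rho$ such that $W_\alpha(\rho)\ge0$ for all $\alpha$ and all quantum nets. Then the unitaries $U$ such that $\rho\mapsto U\rho U^\dagger$ maps $C_d$ into $C_d$ form a subgroup of the Clifford group, and they are exactly the unitaries that map the pure states in $C_d$ to pure states in $C_d$. The same holds if only the translation-covariant nets are used: given an additive isomorphism $L:F\times F\to(\mathbb Z/p)^{n}\times(\mathbb Z/p)^{n}$ that maps the nonzero points of each line through the origin onto the labels $(q,s)$ of one of the sets of the partition defining $B$, these are the nets with $P_{l+\alpha}=T_\alpha P_l T_\alpha^\dagger$ for all lines $l$ and all $\alpha\in F\times F$, where $T_\alpha=X^qZ^s$ for $(q,s)=L(\alpha)$. -/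

import Mathlib

open scoped ComplexOrder

noncomputable section

namespace DiscreteWigner

/-! ### Pauli operators on `n` registers of prime dimension `p` -/

/-- Labels `(q, s)` of the Pauli operators `X^q Z^s`, modulo phases. -/
abbrev PauliLabel (p n : ℕ) : Type := (Fin n → ZMod p) × (Fin n → ZMod p)

/-- Operators on the Hilbert space `(ℂ^p)^{⊗ n}`, of dimension `d = p ^ n`, in the computational
basis `|j⟩`, `j ∈ (ℤ/p)^n`. -/
abbrev Op (p n : ℕ) : Type := Matrix (Fin n → ZMod p) (Fin n → ZMod p) ℂ

/-- The unitary group of the Hilbert space. -/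
abbrev UGroup (p n : ℕ) [Fact p.Prime] : Type := Matrix.unitaryGroup (Fin n → ZMod p) ℂ

/-- The Pauli operator `X^q Z^s`, that is `|j⟩ ↦ ω ^ (s · j) |j + q⟩` with `ω = exp (2πi/p)`. -/
def pauliOp {p n : ℕ} [Fact p.Prime] (v : PauliLabel p n) : Op p n :=
  Matrix.of fun i j => if i = j + v.1 then ZMod.stdAddChar (v.2 ⬝ᵥ j) else 0

/-- The phases allowed in the Pauli group are the powers of `i` for qubits and the powers of
`ω = exp (2πi/p)` for odd `p`. -/
def phaseOrder (p : ℕ) : ℕ := if p = 2 then 4 else p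

theorem stdAddChar_pow_phaseOrder {p : ℕ} [Fact p.Prime] (a : ZMod p) :
    (ZMod.stdAddChar a : ℂ) ^ phaseOrder p = 1 := by
  have h : (ZMod.stdAddChar a : ℂ) ^ p = 1 := by
    rw [← AddChar.map_nsmul_eq_pow]; simp
  unfold phaseOrder
  split_ifs with hp
  · subst hp
    rw [show (4 : ℕ) = 2 * 2 from rfl, pow_mul, h, one_pow]
  · exact h

theorem pauliOp_zero {p n : ℕ} [Fact p.Prime] : pauliOp (0 : PauliLabel p n) = 1 := by
  ext i j
  simp [pauliOp, Matrix.one_apply]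

theorem pauliOp_mul {p n : ℕ} [Fact p.Prime] (v w : PauliLabel p n) :
    pauliOp v * pauliOp w = (ZMod.stdAddChar (v.2 ⬝ᵥ w.1) : ℂ) • pauliOp (v + w) := by
  ext i j
  rw [Matrix.mul_apply, Finset.sum_eq_single (j + w.1)]
  · simp only [pauliOp, Matrix.of_apply, Matrix.smul_apply, if_true, smul_eq_mul, Prod.fst_add,
      Prod.snd_add]
    have : i = j + w.1 + v.1 ↔ i = j + (v.1 + w.1) := by
      rw [add_assoc, add_comm w.1]
    simp only [this]
    split_ifs
    · rw [dotProduct_add, add_dotProduct, AddChar.map_add_eq_mul, AddChar.map_add_eq_mul]; ring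
    · simp
  · intro k _ hk
    simp [pauliOp, hk]
  · simp

/-- The Pauli group of `n` registers: all `c X^q Z^s` with an allowed phase `c`. -/
def pauliGroup (p n : ℕ) [Fact p.Prime] : Subgroup (UGroup p n) where
  carrier := {U | ∃ (c : ℂ) (v : PauliLabel p n), c ^ phaseOrder p = 1 ∧ (U : Op p n) = c • pauliOp v}
  one_mem' := ⟨1, 0, by simp, by simp [pauliOp_zero]⟩
  mul_mem' := by
    rintro U V ⟨c, v, hc, hU⟩ ⟨c', w, hc', hV⟩
    refine ⟨c * c' * ZMod.stdAddChar (v.2 ⬝ᵥ w.1), v + w, ?_, ?_⟩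
    · rw [mul_pow, mul_pow, hc, hc', stdAddChar_pow_phaseOrder]; simp
    · rw [Submonoid.coe_mul, hU, hV, smul_mul_smul_comm, pauliOp_mul, smul_smul]
  inv_mem' := by
    rintro U ⟨c, v, hc, hU⟩
    have hp : phaseOrder p ≠ 0 := by
      unfold phaseOrder
      split_ifs
      · norm_num
      · exact (Fact.out : p.Prime).ne_zero
    have hc0 : c ≠ 0 := by
      rintro rfl
      rw [zero_pow hp] at hc
      exact zero_ne_one hc
    set e : ℂ := ZMod.stdAddChar (v.2 ⬝ᵥ (-v).1) with he
    have he1 : e ^ phaseOrder p = 1 := stdAddChar_pow_phaseOrder _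
    have he0 : e ≠ 0 := by
      intro h
      rw [h, zero_pow hp] at he1
      exact zero_ne_one he1
    refine ⟨c⁻¹ * e⁻¹, -v, by rw [mul_pow, inv_pow, inv_pow, hc, he1]; simp, ?_⟩
    have h1 : (U : Op p n) * ((c⁻¹ * e⁻¹) • pauliOp (-v)) = 1 := by
      rw [hU, smul_mul_smul_comm, pauliOp_mul, add_neg_cancel, pauliOp_zero, smul_smul, ← he]
      have : c * (c⁻¹ * e⁻¹) * e = 1 := by field_simp
      rw [this, one_smul]
    have h2 : ((U⁻¹ : UGroup p n) : Op p n) * (U : Op p n) = 1 := by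
      rw [← Submonoid.coe_mul, inv_mul_cancel]; rfl
    calc ((U⁻¹ : UGroup p n) : Op p n)
        = ((U⁻¹ : UGroup p n) : Op p n) * ((U : Op p n) * ((c⁻¹ * e⁻¹) • pauliOp (-v))) := by
          rw [h1, mul_one]
      _ = (c⁻¹ * e⁻¹) • pauliOp (-v) := by rw [← mul_assoc, h2, one_mul]

/-- The Clifford group: the unitaries that map Pauli operators to Pauli operators under
conjugation. -/
def cliffordGroup (p n : ℕ) [Fact p.Prime] : Subgroup (UGroup p n) :=
  Subgroup.normalizer (pauliGroup p n : Set (UGroup p n))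

/-- The action `A ↦ U A U†` of a unitary on operators. -/
def conjBy {p n : ℕ} [Fact p.Prime] (U : UGroup p n) (A : Op p n) : Op p n :=
  (U : Op p n) * A * (U : Op p n).conjTranspose

/-! ### Complete sets of Pauli mutually unbiased bases -/

/-- A partition of the `d ^ 2 - 1` Pauli operators other than the identity (taken modulo phases)
into `d + 1` sets of `d - 1` mutually commuting operators each, `d = p ^ n`. -/
structure PauliPartition (p n : ℕ) [Fact p.Prime] where
  parts : Finset (Finset (PauliLabel p n))
  card_parts : parts.card = p ^ n + 1
  zero_notMem : ∀ S ∈ parts, (0 : PauliLabel p n) ∉ S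
  existsUnique_mem : ∀ v : PauliLabel p n, v ≠ 0 → ∃! S, S ∈ parts ∧ v ∈ S
  card_part : ∀ S ∈ parts, S.card = p ^ n - 1
  commute : ∀ S ∈ parts, ∀ v ∈ S, ∀ w ∈ S, Commute (pauliOp v) (pauliOp w)

/-- The pure states: projectors `|ψ⟩⟨ψ|` onto unit vectors. -/
def pureStates (p n : ℕ) [Fact p.Prime] : Set (Op p n) :=
  {P | ∃ ψ : (Fin n → ZMod p) → ℂ, star ψ ⬝ᵥ ψ = 1 ∧ P = Matrix.vecMulVec ψ (star ψ)}

/-- The projectors `|ψ⟩⟨ψ|` onto the joint eigenstates `ψ` of the Pauli operators in `S`. -/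
def jointEigenprojectors {p n : ℕ} [Fact p.Prime] (S : Finset (PauliLabel p n)) : Set (Op p n) :=
  {P | ∃ ψ : (Fin n → ZMod p) → ℂ, star ψ ⬝ᵥ ψ = 1 ∧
    (∀ v ∈ S, ∃ c : ℂ, (pauliOp v).mulVec ψ = c • ψ) ∧ P = Matrix.vecMulVec ψ (star ψ)}

/-- The complete set of Pauli mutually unbiased bases given by a partition of the Pauli operators:
one basis for each set of the partition, formed by the joint eigenstates of that set. Bases are
identified with their sets of rank-one projectors, since neither the order nor the phases of
the basis vectors matter. -/
def PauliPartition.mub {p n : ℕ} [Fact p.Prime] (B : PauliPartition p n) : Set (Set (Op p n)) :=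
  {b | ∃ S ∈ B.parts, b = jointEigenprojectors S}

/-- The unitary `U` maps the complete set of bases `B₁` onto the complete set of bases `B₂`. -/
def MapsMUB {p n : ℕ} [Fact p.Prime] (U : UGroup p n) (B₁ B₂ : PauliPartition p n) : Prop :=
  (fun b => conjBy U '' b) '' B₁.mub = B₂.mub

/-! ### Discrete phase space, quantum nets and Wigner functions -/

/-- The line `a q + b p = c` of the phase space `F × F`. -/
def phaseLine {F : Type*} [Field F] (a b c : F) : Set (F × F) :=
  {x | a * x.1 + b * x.2 = c}

/-- The lines of phase space. -/
def phaseLines (F : Type*) [Field F] : Set (Set (F × F)) :=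
  {l | ∃ a b c : F, (a ≠ 0 ∨ b ≠ 0) ∧ l = phaseLine a b c}

/-- The striations of phase space: the sets of all lines `a q + b p = c` for fixed `(a, b)`. -/
def striations (F : Type*) [Field F] : Set (Set (Set (F × F))) :=
  {s | ∃ a b : F, (a ≠ 0 ∨ b ≠ 0) ∧ s = Set.range (phaseLine a b)}

/-- The quantum nets on the phase space `F × F` obtained from `B`: the striations are matched with
the bases of `B`, and the lines in each striation with the projectors of its basis. (The value
of a net at a set that is not a line is irrelevant.) -/
def quantumNets (F : Type*) [Field F] {p n : ℕ} [Fact p.Prime] (B : PauliPartition p n) :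
    Set (Set (F × F) → Op p n) :=
  {N | ∃ κ : Set (Set (F × F)) → Set (Op p n), Set.BijOn κ (striations F) B.mub ∧
    ∀ s ∈ striations F, Set.BijOn N s (κ s)}

/-- A labelling `L` of phase-space translations by Pauli operators is adapted to `B` if it sends
the translations along each ray (line through the origin) to one set of the partition. -/
def IsAdapted {F : Type*} [Field F] {p n : ℕ} [Fact p.Prime] (B : PauliPartition p n)
    (L : F × F ≃+ PauliLabel p n) : Prop :=
  ∀ a b : F, (a ≠ 0 ∨ b ≠ 0) →
    ∃ S ∈ B.parts, (S : Set (PauliLabel p n)) = L '' (phaseLine a b 0 \ {0})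

/-- The quantum nets that are covariant under phase-space translations: the projector of a
translated line is obtained by conjugation with the corresponding Pauli operator. -/
def covariantNets {F : Type*} [Field F] {p n : ℕ} [Fact p.Prime] (B : PauliPartition p n)
    (L : F × F ≃+ PauliLabel p n) : Set (Set (F × F) → Op p n) :=
  {N | N ∈ quantumNets F B ∧ ∀ l ∈ phaseLines F, ∀ α : F × F,
    N ((fun x => x + α) '' l) = pauliOp (L α) * N l * (pauliOp (L α)).conjTranspose}

open scoped Classical in
/-- The phase-space point operator `A(α) = (1/d) (∑_{l ∋ α} N l - 1)`, where `l` ranges over the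
lines through `α`. -/
def pointOp {F : Type*} [Field F] [Fintype F] {p n : ℕ} [Fact p.Prime]
    (N : Set (F × F) → Op p n) (α : F × F) : Op p n :=
  (1 / (p : ℂ) ^ n) • ((∑ l : Set (F × F) with l ∈ phaseLines F ∧ α ∈ l, N l) - 1)

/-- The discrete Wigner function `W_α = Tr (ρ A(α))` of `ρ` (a real number for Hermitian `ρ`). -/
def wigner {F : Type*} [Field F] [Fintype F] {p n : ℕ} [Fact p.Prime]
    (N : Set (F × F) → Op p n) (ρ : Op p n) (α : F × F) : ℝ :=
  (Matrix.trace (ρ * pointOp N α)).re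

/-- The density matrices whose Wigner function is non-negative at every point, for all quantum
nets in `𝒩`. -/
def nonnegStates {F : Type*} [Field F] [Fintype F] {p n : ℕ} [Fact p.Prime]
    (𝒩 : Set (Set (F × F) → Op p n)) : Set (Op p n) :=
  {ρ | ρ.PosSemidef ∧ ρ.trace = 1 ∧ ∀ N ∈ 𝒩, ∀ α, 0 ≤ wigner N ρ α}

/-- The unitaries that preserve the non-negativity of `W` for all quantum nets in `𝒩`. -/
def nonnegPreserving {F : Type*} [Field F] [Fintype F] {p n : ℕ} [Fact p.Prime]
    (𝒩 : Set (Set (F × F) → Op p n)) : Set (UGroup p n) :=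
  {U | Set.MapsTo (conjBy U) (nonnegStates 𝒩) (nonnegStates 𝒩)}

/-- The unitaries that map the pure states with non-negative `W` for all quantum nets in `𝒩` to
such pure states. -/
def pureNonnegPreserving {F : Type*} [Field F] [Fintype F] {p n : ℕ} [Fact p.Prime]
    (𝒩 : Set (Set (F × F) → Op p n)) : Set (UGroup p n) :=
  {U | Set.MapsTo (conjBy U) (nonnegStates 𝒩 ∩ pureStates p n) (nonnegStates 𝒩 ∩ pureStates p n)}

/-- The unitaries preserving non-negativity of `W` for all quantum nets in `𝒩` (on all states, or
equally on pure states only) form a subgroup of the Clifford group. -/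
def FormCliffordSubgroup {F : Type*} [Field F] [Fintype F] {p n : ℕ} [Fact p.Prime]
    (𝒩 : Set (Set (F × F) → Op p n)) : Prop :=
  ∃ G : Subgroup (UGroup p n), G ≤ cliffordGroup p n ∧
    (G : Set (UGroup p n)) = nonnegPreserving 𝒩 ∧
    (G : Set (UGroup p n)) = pureNonnegPreserving 𝒩

end DiscreteWigner

end

/-!
Write `T_v` for the Pauli operator with label `v`, and `d = p ^ n`. The `T_v` form an orthogonal
basis of the operators, so an operator is determined by its coefficients `Tr (T_v† A)` (`op_ext`),
and `T_w` acts on the coefficient at `v` by the phase `ω ^ sympl w v`. Counting shows that each set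
of the partition, together with `0`, is its own commutant (`PauliPartition.isLagrangian`). Hence the
projectors of the corresponding basis have coefficients supported on that set, are permuted
transitively by the Pauli operators, and are unbiased with respect to those of the other bases.

*Unitaries between complete sets of bases.* A unitary `V` which is diagonal in one basis and permutes
a second one agrees on a state of the second basis with a Pauli operator `T_h` that is diagonal in
the first, since these act transitively on the second basis. Then `T_h† V` commutes with all the
Pauli operators diagonal in the first basis and fixes a vector whose translates by them span the
space, so it is a scalar (`exists_eq_smul_pauliOp`). If `U` maps complete sets of bases to each
other, this applies to `V = U T_v U†` with the image of the basis in which `T_v` is diagonal as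
first and the image of any other basis as second basis. Thus `U` is Clifford
(`MapsMUB.mem_cliffordGroup`).

*Non-negative states.* For a fixed point of phase space, the nets, covariant or not, realize every
choice of one projector `f S` from each basis on the lines through that point. So in both cases the
set `C_d` is given by the inequalities `1 ≤ ∑_S Tr (ρ f(S))` (`nonnegStates_eq_witnessedStates`).
Applying the strongest of them to the expansion of `ρ` in the projectors of all the bases
(`sum_sum_trace_smul`) exhibits `ρ` as a combination with non-negative coefficients of the identity
and these projectors (`exists_decomposition`). By extremality, the pure states in `C_d` are exactly
the states of the bases. Therefore a unitary preserves `C_d`, or the pure states in it, if and only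
if it permutes the states of the bases. It then permutes the bases themselves, because two states
lie in the same basis if and only if they are equal or orthogonal, and it is Clifford by the first
part.
-/

noncomputable section

namespace DiscreteWigner

open Matrix
open scoped Classical

/-! ### The Pauli operators as an orthogonal operator basis -/

variable {p n : ℕ} [Fact p.Prime]

/-- The symplectic form on Pauli labels: `X^q Z^s` and `X^q' Z^s'` commute up to the phase
`ω ^ (s · q' - s' · q)`. -/
def sympl (v w : PauliLabel p n) : ZMod p := v.2 ⬝ᵥ w.1 - w.2 ⬝ᵥ v.1

theorem sympl_add_left (u v w : PauliLabel p n) : sympl (u + v) w = sympl u w + sympl v w := by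
  simp only [sympl, Prod.snd_add, Prod.fst_add, add_dotProduct, dotProduct_add]; ring

theorem sympl_add_right (u v w : PauliLabel p n) : sympl u (v + w) = sympl u v + sympl u w := by
  simp only [sympl, Prod.snd_add, Prod.fst_add, add_dotProduct, dotProduct_add]; ring

theorem sympl_swap (v w : PauliLabel p n) : sympl v w = -sympl w v := by
  simp only [sympl]; ring

@[simp] theorem sympl_zero_left (v : PauliLabel p n) : sympl 0 v = 0 := by simp [sympl]

@[simp] theorem sympl_zero_right (v : PauliLabel p n) : sympl v 0 = 0 := by simp [sympl]

theorem sympl_neg_left (v w : PauliLabel p n) : sympl (-v) w = -sympl v w := by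
  rw [eq_neg_iff_add_eq_zero, ← sympl_add_left, neg_add_cancel, sympl_zero_left]

theorem sympl_neg_right (v w : PauliLabel p n) : sympl v (-w) = -sympl v w := by
  rw [eq_neg_iff_add_eq_zero, ← sympl_add_right, neg_add_cancel, sympl_zero_right]

@[simp] theorem sympl_self (v : PauliLabel p n) : sympl v v = 0 := by simp [sympl]

theorem eq_zero_of_sympl_eq_zero {v : PauliLabel p n} (h : ∀ w, sympl w v = 0) : v = 0 := by
  ext i
  · have := h (0, Pi.single i 1)
    simpa [sympl] using this
  · have := h (Pi.single i 1, 0)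
    simpa [sympl] using this

/-- The character `w ↦ ω ^ sympl w v` of the group of Pauli labels. -/
def symplChar (v : PauliLabel p n) : AddChar (PauliLabel p n) ℂ where
  toFun w := ZMod.stdAddChar (sympl w v)
  map_zero_eq_one' := by simp
  map_add_eq_mul' u w := by rw [sympl_add_left, AddChar.map_add_eq_mul]

theorem symplChar_apply (v w : PauliLabel p n) :
    symplChar v w = (ZMod.stdAddChar (sympl w v) : ℂ) := rfl

theorem stdAddChar_eq_one_iff {a : ZMod p} : (ZMod.stdAddChar a : ℂ) = 1 ↔ a = 0 := by
  rw [← (ZMod.stdAddChar (N := p)).map_zero_eq_one]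
  exact ZMod.injective_stdAddChar.eq_iff

theorem star_stdAddChar (a : ZMod p) :
    star (ZMod.stdAddChar a : ℂ) = ZMod.stdAddChar (-a) := by
  rw [AddChar.map_neg_eq_inv, ZMod.stdAddChar_apply, ← Circle.coe_inv, Circle.coe_inv_eq_conj]
  rfl

/-- The commutant of a set of labels, that is its orthogonal for the symplectic form. -/
def perp (S : Set (PauliLabel p n)) : AddSubgroup (PauliLabel p n) where
  carrier := {v | ∀ h ∈ S, sympl h v = 0}
  zero_mem' := by simp
  add_mem' := by
    intro v w hv hw h hh
    rw [sympl_add_right, hv h hh, hw h hh, add_zero]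
  neg_mem' := by
    intro v hv h hh
    rw [sympl_neg_right, hv h hh, neg_zero]

theorem mem_perp {S : Set (PauliLabel p n)} {v : PauliLabel p n} :
    v ∈ perp S ↔ ∀ h ∈ S, sympl h v = 0 := Iff.rfl

theorem sum_stdAddChar_sympl (H : AddSubgroup (PauliLabel p n)) (v : PauliLabel p n) :
    ∑ h : H, (ZMod.stdAddChar (sympl (h : PauliLabel p n) v) : ℂ) =
      if v ∈ perp (H : Set (PauliLabel p n)) then (Nat.card H : ℂ) else 0 := by
  have h1 := AddChar.sum_eq_ite ((symplChar v).compAddMonoidHom H.subtype)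
  have h2 : (symplChar v).compAddMonoidHom H.subtype = 0 ↔
      v ∈ perp (H : Set (PauliLabel p n)) := by
    rw [AddChar.ext_iff, mem_perp]
    simp [symplChar_apply, stdAddChar_eq_one_iff]
  simp only [h2] at h1
  simpa [symplChar_apply] using h1

theorem mem_perp_top {v : PauliLabel p n} :
    v ∈ perp ((⊤ : AddSubgroup (PauliLabel p n)) : Set (PauliLabel p n)) ↔ v = 0 := by
  constructor
  · intro h
    exact eq_zero_of_sympl_eq_zero fun w => h w trivial
  · rintro rfl
    exact zero_mem _

theorem sum_stdAddChar_sympl_univ (v : PauliLabel p n) :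
    ∑ w : PauliLabel p n, (ZMod.stdAddChar (sympl w v) : ℂ) =
      if v = 0 then (p : ℂ) ^ (2 * n) else 0 := by
  have h1 := AddChar.sum_eq_ite (symplChar v)
  have h2 : symplChar v = 0 ↔ v = 0 := by
    rw [AddChar.ext_iff, ← mem_perp_top, mem_perp]
    simp [symplChar_apply, stdAddChar_eq_one_iff]
  simp only [h2] at h1
  simpa [symplChar_apply, two_mul, pow_add] using h1

/-- A subgroup of Pauli labels and its commutant have complementary sizes. -/
theorem card_mul_card_perp (H : AddSubgroup (PauliLabel p n)) :
    Nat.card H * Nat.card (perp (H : Set (PauliLabel p n))) = p ^ (2 * n) := by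
  have h1 : ∑ v : PauliLabel p n, ∑ h : H, (ZMod.stdAddChar (sympl (h : PauliLabel p n) v) : ℂ)
      = Nat.card H * Nat.card (perp (H : Set (PauliLabel p n))) := by
    simp_rw [sum_stdAddChar_sympl]
    rw [← Finset.sum_filter, Finset.sum_const, nsmul_eq_mul, mul_comm, Nat.card_eq_fintype_card
      (α := perp (H : Set (PauliLabel p n))), Fintype.card_subtype]
  have h2 : ∑ h : H, ∑ v : PauliLabel p n, (ZMod.stdAddChar (sympl (h : PauliLabel p n) v) : ℂ)
      = (p : ℂ) ^ (2 * n) := by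
    have : ∀ h : H, ∑ v : PauliLabel p n, (ZMod.stdAddChar (sympl (h : PauliLabel p n) v) : ℂ)
        = if h = 0 then (p : ℂ) ^ (2 * n) else 0 := by
      intro h
      have := sum_stdAddChar_sympl_univ (-(h : PauliLabel p n))
      simp only [neg_eq_zero, ZeroMemClass.coe_eq_zero] at this
      rw [← this]
      refine Finset.sum_congr rfl fun v _ => ?_
      rw [sympl_neg_right, ← sympl_swap]
    simp [this]
  rw [Finset.sum_comm, h2] at h1
  exact_mod_cast h1.symm

theorem pauliOp_conjTranspose (v : PauliLabel p n) :
    (pauliOp v)ᴴ = (ZMod.stdAddChar (v.2 ⬝ᵥ v.1) : ℂ) • pauliOp (-v) := by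
  ext i j
  simp only [pauliOp, conjTranspose_apply, of_apply, Matrix.smul_apply, Prod.fst_neg, Prod.snd_neg,
    smul_eq_mul]
  by_cases h : j = i + v.1
  · subst h
    simp only [if_true, add_neg_cancel_right, neg_dotProduct, star_stdAddChar, dotProduct_add]
    rw [← AddChar.map_add_eq_mul]
    congr 1; ring
  · have h' : ¬ i = j + -v.1 := by
      rintro rfl; simp at h
    simp [h, h']

theorem pauliOp_mul_conjTranspose (v : PauliLabel p n) : pauliOp v * (pauliOp v)ᴴ = 1 := by
  rw [pauliOp_conjTranspose, mul_smul_comm, pauliOp_mul, add_neg_cancel, pauliOp_zero, smul_smul,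
    ← AddChar.map_add_eq_mul]
  simp

theorem pauliOp_conjTranspose_mul (v : PauliLabel p n) : (pauliOp v)ᴴ * pauliOp v = 1 :=
  mul_eq_one_comm.mp (pauliOp_mul_conjTranspose v)

theorem pauliOp_mul_comm (v w : PauliLabel p n) :
    pauliOp v * pauliOp w = (ZMod.stdAddChar (sympl v w) : ℂ) • (pauliOp w * pauliOp v) := by
  rw [pauliOp_mul, pauliOp_mul, smul_smul, ← AddChar.map_add_eq_mul, add_comm w v]
  congr 2
  simp only [sympl]; ring

theorem commute_pauliOp_iff (v w : PauliLabel p n) :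
    Commute (pauliOp v) (pauliOp w) ↔ sympl v w = 0 := by
  constructor
  · intro h
    have h1 := pauliOp_mul_comm v w
    rw [h.eq] at h1
    have h2 : (1 : Op p n) = (ZMod.stdAddChar (sympl v w) : ℂ) • (1 : Op p n) := by
      calc (1 : Op p n) = (pauliOp w * pauliOp v) * ((pauliOp v)ᴴ * (pauliOp w)ᴴ) := by
            rw [mul_assoc, ← mul_assoc (pauliOp v), pauliOp_mul_conjTranspose, one_mul,
              pauliOp_mul_conjTranspose]
        _ = _ := by
            rw [h1, smul_mul_assoc, mul_assoc, ← mul_assoc (pauliOp v),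
              pauliOp_mul_conjTranspose, one_mul, pauliOp_mul_conjTranspose]
    have h3 := congrFun (congrFun h2 0) 0
    simp only [one_apply_eq, Matrix.smul_apply, smul_eq_mul, mul_one] at h3
    exact stdAddChar_eq_one_iff.mp h3.symm
  · intro h
    have h1 := pauliOp_mul_comm v w
    rw [h, AddChar.map_zero_eq_one, one_smul] at h1
    exact h1

/-- The coefficient `Tr (T_v† A)` of the operator `A` at the Pauli operator `T_v`. -/
def coef (A : Op p n) (v : PauliLabel p n) : ℂ := ((pauliOp v)ᴴ * A).trace

theorem coef_add (A B : Op p n) (v : PauliLabel p n) : coef (A + B) v = coef A v + coef B v := by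
  simp [coef, mul_add]

theorem coef_smul (c : ℂ) (A : Op p n) (v : PauliLabel p n) : coef (c • A) v = c * coef A v := by
  simp [coef]

theorem coef_sum {ι : Type*} (s : Finset ι) (A : ι → Op p n) (v : PauliLabel p n) :
    coef (∑ i ∈ s, A i) v = ∑ i ∈ s, coef (A i) v := by
  simp [coef, Finset.mul_sum, trace_sum]

theorem coef_zero (A : Op p n) : coef A 0 = A.trace := by simp [coef, pauliOp_zero]

/-- The Pauli operators span: an operator is determined by its Pauli coefficients. -/
theorem sum_coef_smul_pauliOp (A : Op p n) :
    ∑ v, coef A v • pauliOp v = (p : ℂ) ^ n • A := by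
  ext i j
  have hco : ∀ v : PauliLabel p n, coef A v =
      ∑ k, ZMod.stdAddChar (-(v.2 ⬝ᵥ k)) * A (k + v.1) k := by
    intro v
    simp only [coef, trace, diag_apply, mul_apply, conjTranspose_apply, pauliOp, of_apply]
    refine Finset.sum_congr rfl fun k _ => ?_
    rw [Finset.sum_eq_single (k + v.1)]
    · rw [if_pos rfl, star_stdAddChar]
    · intro l _ hl
      simp [hl]
    · simp
  have hs : ∀ k : Fin n → ZMod p, ∑ s : Fin n → ZMod p, (ZMod.stdAddChar (s ⬝ᵥ k) : ℂ) =
      if k = 0 then (p : ℂ) ^ n else 0 := by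
    intro k
    let ψ : AddChar (Fin n → ZMod p) ℂ :=
      { toFun := fun s => ZMod.stdAddChar (s ⬝ᵥ k)
        map_zero_eq_one' := by simp
        map_add_eq_mul' := fun s t => by rw [add_dotProduct, AddChar.map_add_eq_mul] }
    have h1 := AddChar.sum_eq_ite ψ
    have h2 : ψ = 0 ↔ k = 0 := by
      constructor
      · intro h
        ext a
        have := DFunLike.congr_fun h (Pi.single a 1)
        have h3 : (ZMod.stdAddChar ((Pi.single a 1 : Fin n → ZMod p) ⬝ᵥ k) : ℂ) = 1 := this
        rw [stdAddChar_eq_one_iff] at h3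
        simpa using h3
      · rintro rfl
        ext s
        change (ZMod.stdAddChar (s ⬝ᵥ 0) : ℂ) = 1
        simp
    simp only [h2] at h1
    simpa [ψ] using h1
  simp only [Matrix.sum_apply, Matrix.smul_apply, smul_eq_mul]
  rw [Fintype.sum_prod_type, Finset.sum_eq_single (i - j)]
  · simp only [hco, pauliOp, of_apply, add_sub_cancel, if_true, Finset.sum_mul]
    rw [Finset.sum_comm, Finset.sum_eq_single j]
    · have : ∀ s : Fin n → ZMod p, (ZMod.stdAddChar (-(s ⬝ᵥ j)) : ℂ) * A (j + (i - j)) j *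
          ZMod.stdAddChar (s ⬝ᵥ j) = A i j := by
        intro s
        rw [mul_right_comm, ← AddChar.map_add_eq_mul, neg_add_cancel, AddChar.map_zero_eq_one,
          one_mul, add_sub_cancel]
      rw [Finset.sum_congr rfl fun s _ => this s]
      simp
    · intro k _ hk
      have : ∀ s : Fin n → ZMod p, (ZMod.stdAddChar (-(s ⬝ᵥ k)) : ℂ) * A (k + (i - j)) k *
          ZMod.stdAddChar (s ⬝ᵥ j) = ZMod.stdAddChar (s ⬝ᵥ (j - k)) * A (k + (i - j)) k := by
        intro s
        rw [mul_right_comm, ← AddChar.map_add_eq_mul, dotProduct_sub]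
        congr 2; ring_nf
      simp only [this]
      rw [← Finset.sum_mul, hs, if_neg (sub_ne_zero.mpr (Ne.symm hk)), zero_mul]
    · simp
  · intro q _ hq
    refine Finset.sum_eq_zero fun s _ => ?_
    have : ¬ i = j + q := by
      rintro rfl; simp at hq
    simp [pauliOp, this]
  · simp

theorem natCast_prime_ne_zero : (p : ℂ) ≠ 0 :=
  Nat.cast_ne_zero.mpr (Fact.out : p.Prime).ne_zero

theorem op_ext {A B : Op p n} (h : ∀ v, coef A v = coef B v) : A = B := by
  have h1 := sum_coef_smul_pauliOp A
  simp only [h] at h1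
  rw [sum_coef_smul_pauliOp] at h1
  exact (smul_right_injective _ (pow_ne_zero n natCast_prime_ne_zero) h1).symm

theorem pauliOp_conj (w v : PauliLabel p n) :
    (pauliOp w)ᴴ * (pauliOp v)ᴴ * pauliOp w =
      (ZMod.stdAddChar (sympl w v) : ℂ) • (pauliOp v)ᴴ := by
  have h1 : pauliOp v * pauliOp w = (ZMod.stdAddChar (-sympl w v) : ℂ) • (pauliOp w * pauliOp v) := by
    rw [pauliOp_mul_comm v w, sympl_swap]
  have h2 := congrArg conjTranspose h1
  rw [conjTranspose_mul, conjTranspose_smul, conjTranspose_mul, star_stdAddChar, neg_neg] at h2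
  rw [h2, smul_mul_assoc, mul_assoc, pauliOp_conjTranspose_mul, mul_one]

theorem coef_conj_pauliOp (A : Op p n) (w v : PauliLabel p n) :
    coef (pauliOp w * A * (pauliOp w)ᴴ) v = ZMod.stdAddChar (sympl w v) * coef A v := by
  rw [coef, coef, mul_assoc, ← mul_assoc, trace_mul_comm, mul_assoc, trace_mul_comm, ← mul_assoc,
    pauliOp_conj, smul_mul_assoc, trace_smul, smul_eq_mul]

/-- Averaging over a subgroup `H` of Pauli operators projects onto the span of the Pauli operators
in the commutant of `H`. -/
theorem coef_twirl (H : AddSubgroup (PauliLabel p n)) (A : Op p n) (v : PauliLabel p n) :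
    coef (∑ h : H, pauliOp (h : PauliLabel p n) * A * (pauliOp (h : PauliLabel p n))ᴴ) v =
      (if v ∈ perp (H : Set (PauliLabel p n)) then (Nat.card H : ℂ) else 0) * coef A v := by
  rw [coef_sum]
  simp_rw [coef_conj_pauliOp]
  rw [← Finset.sum_mul, sum_stdAddChar_sympl]

theorem trace_one_op : (1 : Op p n).trace = (p : ℂ) ^ n := by simp

theorem coef_one (v : PauliLabel p n) :
    coef (1 : Op p n) v = if v = 0 then (p : ℂ) ^ n else 0 := by
  split_ifs with h
  · rw [h, coef_zero, trace_one_op]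
  · by_contra h0
    apply h
    refine eq_zero_of_sympl_eq_zero fun w => ?_
    have h1 := coef_conj_pauliOp (1 : Op p n) w v
    rw [mul_one, pauliOp_mul_conjTranspose, eq_comm, mul_eq_right₀ h0] at h1
    exact stdAddChar_eq_one_iff.mp h1

/-- The average over all Pauli operators is the completely depolarizing channel. -/
theorem sum_conj_pauliOp (A : Op p n) :
    ∑ w, pauliOp w * A * (pauliOp w)ᴴ = ((p : ℂ) ^ n * A.trace) • (1 : Op p n) := by
  refine op_ext fun v => ?_
  rw [coef_sum, coef_smul, coef_one]
  simp_rw [coef_conj_pauliOp]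
  rw [← Finset.sum_mul, sum_stdAddChar_sympl_univ]
  split_ifs with h
  · rw [h, coef_zero]; ring
  · simp

/-! ### The sets of a Pauli partition are Lagrangian -/

/-- A set of nonzero labels is Lagrangian if, together with `0`, it is its own commutant. -/
structure IsLagrangian (S : Finset (PauliLabel p n)) : Prop where
  zero_notMem : (0 : PauliLabel p n) ∉ S
  mem_perp_iff : ∀ v, v ∈ perp (S : Set (PauliLabel p n)) ↔ v = 0 ∨ v ∈ S

theorem IsLagrangian.mem_perp {S : Finset (PauliLabel p n)} (hS : IsLagrangian S)
    {v : PauliLabel p n} (hv : v ∈ S) : v ∈ perp (S : Set (PauliLabel p n)) :=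
  (hS.mem_perp_iff v).mpr (Or.inr hv)

theorem IsLagrangian.perp_perp {S : Finset (PauliLabel p n)} (hS : IsLagrangian S) :
    perp (perp (S : Set (PauliLabel p n)) : Set (PauliLabel p n)) = perp S := by
  ext v
  constructor
  · intro hv h hh
    exact hv h (hS.mem_perp hh)
  · intro hv h hh
    rcases (hS.mem_perp_iff h).mp hh with rfl | hh
    · simp
    · exact hv h hh

theorem IsLagrangian.card_perp {S : Finset (PauliLabel p n)} (hS : IsLagrangian S) :
    Nat.card (perp (S : Set (PauliLabel p n))) = p ^ n := by
  have h := card_mul_card_perp (perp (S : Set (PauliLabel p n)))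
  rw [hS.perp_perp, mul_comm 2, pow_mul, sq] at h
  exact Nat.mul_self_inj.mp h

/-- An isotropic set of `p ^ n - 1` nonzero labels is Lagrangian: the isotropic subgroup it
generates has at most `p ^ n` elements, because its commutant is at least as large. -/
theorem PauliPartition.isLagrangian (B : PauliPartition p n) {S : Finset (PauliLabel p n)}
    (hS : S ∈ B.parts) : IsLagrangian S := by
  set K := perp (S : Set (PauliLabel p n)) with hK
  set H := AddSubgroup.closure (S : Set (PauliLabel p n)) with hH
  have hperp : perp (H : Set (PauliLabel p n)) = K := by
    ext v
    constructor
    · intro hv h hh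
      exact hv h (AddSubgroup.subset_closure hh)
    · intro hv h hh
      induction hh using AddSubgroup.closure_induction with
      | mem x hx => exact hv x hx
      | zero => simp
      | add x y _ _ hx hy => rw [sympl_add_left, hx, hy, add_zero]
      | neg x _ hx => rw [sympl_neg_left, hx, neg_zero]
  have hSK : (S : Set (PauliLabel p n)) ⊆ K := fun v hv h hh =>
    (commute_pauliOp_iff h v).mp (B.commute S hS h hh v hv)
  have hHK : H ≤ K := (AddSubgroup.closure_le K).mpr hSK
  have hpos : 0 < p ^ n := pow_pos (Fact.out : p.Prime).pos n
  have hcard : (insert 0 S).card = p ^ n := by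
    rw [Finset.card_insert_of_notMem (B.zero_notMem S hS), B.card_part S hS]
    omega
  have hsub : ((insert 0 S : Finset (PauliLabel p n)) : Set (PauliLabel p n)) ⊆ H := by
    intro v hv
    rw [Finset.coe_insert] at hv
    rcases hv with rfl | hv
    · exact zero_mem H
    · exact AddSubgroup.subset_closure hv
  have h1 : p ^ n ≤ Nat.card H := by
    have := Set.ncard_le_ncard hsub (Set.toFinite _)
    rw [Set.ncard_coe_finset, hcard] at this
    exact this
  have h3 := card_mul_card_perp H
  rw [hperp, mul_comm 2, pow_mul, sq] at h3
  have h4 : Nat.card K ≤ p ^ n := by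
    refine le_of_mul_le_mul_left ?_ hpos
    rw [← h3]
    exact Nat.mul_le_mul_right _ h1
  have h5 : ((insert 0 S : Finset (PauliLabel p n)) : Set (PauliLabel p n)) = K := by
    refine Set.eq_of_subset_of_ncard_le (hsub.trans hHK) ?_ (Set.toFinite _)
    rw [Set.ncard_coe_finset, hcard]
    exact h4
  refine ⟨B.zero_notMem S hS, fun v => ?_⟩
  have h6 : v ∈ K ↔ v ∈ ((insert 0 S : Finset (PauliLabel p n)) : Set (PauliLabel p n)) := by
    rw [h5]; rfl
  rw [h6, Finset.coe_insert, Set.mem_insert_iff, Finset.mem_coe]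

theorem PauliPartition.eq_of_mem (B : PauliPartition p n) {S S' : Finset (PauliLabel p n)}
    (hS : S ∈ B.parts) (hS' : S' ∈ B.parts) {v : PauliLabel p n} (hv : v ∈ S) (hv' : v ∈ S') :
    S = S' := by
  have h0 : v ≠ 0 := by
    rintro rfl
    exact B.zero_notMem S hS hv
  exact (B.existsUnique_mem v h0).unique ⟨hS, hv⟩ ⟨hS', hv'⟩

theorem PauliPartition.eq_zero_of_mem_perp (B : PauliPartition p n)
    {S S' : Finset (PauliLabel p n)} (hS : S ∈ B.parts) (hS' : S' ∈ B.parts) (hne : S ≠ S')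
    {v : PauliLabel p n} (hv : v ∈ perp (S : Set (PauliLabel p n)))
    (hv' : v ∈ perp (S' : Set (PauliLabel p n))) : v = 0 := by
  rcases ((B.isLagrangian hS).mem_perp_iff v).mp hv with h | h
  · exact h
  rcases ((B.isLagrangian hS').mem_perp_iff v).mp hv' with h' | h'
  · exact h'
  exact absurd (B.eq_of_mem hS hS' h h') hne

/-- A complete set of bases only exists if there is at least one register. -/
theorem PauliPartition.one_lt_dim (B : PauliPartition p n) : 1 < p ^ n := by
  rcases Nat.eq_zero_or_pos n with rfl | hn
  · exfalso
    have hsub : B.parts ⊆ {∅} := by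
      intro S hS
      have := B.card_part S hS
      simpa using this
    have := Finset.card_le_card hsub
    rw [B.card_parts] at this
    simp at this
  · exact Nat.one_lt_pow hn.ne' (Fact.out : p.Prime).one_lt

/-! ### Pure states and joint eigenprojectors -/

theorem conjTranspose_of_mem_pureStates {R : Op p n} (hR : R ∈ pureStates p n) : Rᴴ = R := by
  obtain ⟨ψ, -, rfl⟩ := hR
  rw [conjTranspose_vecMulVec, star_star]

theorem trace_of_mem_pureStates {R : Op p n} (hR : R ∈ pureStates p n) : R.trace = 1 := by
  obtain ⟨ψ, h, rfl⟩ := hR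
  rw [trace_vecMulVec, dotProduct_comm, h]

theorem mul_mul_of_mem_pureStates {R : Op p n} (hR : R ∈ pureStates p n) (A : Op p n) :
    R * A * R = (R * A).trace • R := by
  obtain ⟨ψ, h, rfl⟩ := hR
  rw [vecMulVec_mul, vecMulVec_mul_vecMulVec, trace_vecMulVec, dotProduct_comm ψ]
  ext i j
  simp only [vecMulVec_apply, Matrix.smul_apply, Pi.smul_apply, smul_eq_mul]
  ring

theorem mul_self_of_mem_pureStates {R : Op p n} (hR : R ∈ pureStates p n) : R * R = R := by
  have := mul_mul_of_mem_pureStates hR 1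
  rwa [mul_one, trace_of_mem_pureStates hR, one_smul] at this

theorem posSemidef_of_mem_pureStates {R : Op p n} (hR : R ∈ pureStates p n) : R.PosSemidef := by
  have := posSemidef_conjTranspose_mul_self R
  rwa [conjTranspose_of_mem_pureStates hR, mul_self_of_mem_pureStates hR] at this

theorem unitary_conj_mem_pureStates {R : Op p n} (hR : R ∈ pureStates p n) (U : UGroup p n) :
    conjBy U R ∈ pureStates p n := by
  obtain ⟨ψ, h, rfl⟩ := hR
  refine ⟨(U : Op p n) *ᵥ ψ, ?_, ?_⟩
  · rw [star_mulVec, ← dotProduct_mulVec, mulVec_mulVec]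
    have : (U : Op p n)ᴴ * (U : Op p n) = 1 := mem_unitaryGroup_iff'.mp U.2
    rw [this, one_mulVec, h]
  · rw [conjBy, mul_vecMulVec, vecMulVec_mul, star_mulVec]

theorem jointEigenprojectors_subset_pureStates (S : Finset (PauliLabel p n)) :
    jointEigenprojectors S ⊆ pureStates p n := by
  rintro R ⟨ψ, h, -, rfl⟩
  exact ⟨ψ, h, rfl⟩

theorem exists_pauliOp_smul {S : Finset (PauliLabel p n)} {R : Op p n}
    (hR : R ∈ jointEigenprojectors S) {v : PauliLabel p n} (hv : v = 0 ∨ v ∈ S) :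
    ∃ c : ℂ, star c * c = 1 ∧ pauliOp v * R = c • R ∧ R * pauliOp v = c • R := by
  have hR' := jointEigenprojectors_subset_pureStates S hR
  rcases hv with rfl | hv
  · exact ⟨1, by simp [pauliOp_zero]⟩
  have hcr : ∃ c : ℂ, pauliOp v * R = c • R := by
    obtain ⟨ψ, -, hc, rfl⟩ := hR
    obtain ⟨c, hc⟩ := hc v hv
    exact ⟨c, by rw [mul_vecMulVec, hc, smul_vecMulVec]⟩
  obtain ⟨c, hc⟩ := hcr
  have h1 : R * (pauliOp v)ᴴ = star c • R := by
    have := congrArg conjTranspose hc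
    rwa [conjTranspose_mul, conjTranspose_smul, conjTranspose_of_mem_pureStates hR'] at this
  have h2 : star c * c = 1 := by
    have h3 : R * (pauliOp v)ᴴ * (pauliOp v * R) = (star c * c) • R := by
      rw [h1, hc, smul_mul_smul_comm, mul_self_of_mem_pureStates hR']
    rw [mul_assoc, ← mul_assoc (pauliOp v)ᴴ, pauliOp_conjTranspose_mul, one_mul,
      mul_self_of_mem_pureStates hR'] at h3
    have h4 := congrArg trace h3
    rw [trace_smul, trace_of_mem_pureStates hR', smul_eq_mul, mul_one] at h4
    exact h4.symm
  refine ⟨c, h2, hc, ?_⟩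
  calc R * pauliOp v = (c * star c) • (R * pauliOp v) := by rw [mul_comm, h2, one_smul]
    _ = c • (R * (pauliOp v)ᴴ * pauliOp v) := by rw [h1, smul_mul_assoc, smul_smul]
    _ = c • R := by rw [mul_assoc, pauliOp_conjTranspose_mul, mul_one]

theorem conj_pauliOp_of_mem {S : Finset (PauliLabel p n)} {R : Op p n}
    (hR : R ∈ jointEigenprojectors S) {v : PauliLabel p n} (hv : v = 0 ∨ v ∈ S) :
    pauliOp v * R * (pauliOp v)ᴴ = R := by
  obtain ⟨c, -, h1, h2⟩ := exists_pauliOp_smul hR hv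
  rw [h1, ← h2, mul_assoc, pauliOp_mul_conjTranspose, mul_one]

theorem coef_eq_zero_of_notMem_perp {S : Finset (PauliLabel p n)} {R : Op p n}
    (hR : R ∈ jointEigenprojectors S) {v : PauliLabel p n}
    (hv : v ∉ perp (S : Set (PauliLabel p n))) : coef R v = 0 := by
  rw [mem_perp] at hv
  push Not at hv
  obtain ⟨h, hh, hne⟩ := hv
  by_contra h0
  have h1 := coef_conj_pauliOp R h v
  rw [conj_pauliOp_of_mem hR (Or.inr hh), eq_comm, mul_eq_right₀ h0] at h1
  exact hne (stdAddChar_eq_one_iff.mp h1)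

theorem coef_ne_zero {S : Finset (PauliLabel p n)} {R : Op p n}
    (hR : R ∈ jointEigenprojectors S) {v : PauliLabel p n} (hv : v = 0 ∨ v ∈ S) :
    coef R v ≠ 0 := by
  obtain ⟨c, hc, h1, -⟩ := exists_pauliOp_smul hR hv
  intro h0
  have h2 : (pauliOp v)ᴴ * (pauliOp v * R) = c • ((pauliOp v)ᴴ * R) := by
    rw [h1, mul_smul_comm]
  rw [← mul_assoc, pauliOp_conjTranspose_mul, one_mul] at h2
  have h3 := congrArg trace h2
  rw [trace_of_mem_pureStates (jointEigenprojectors_subset_pureStates S hR), trace_smul] at h3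
  rw [coef] at h0
  rw [h0, smul_zero] at h3
  exact one_ne_zero h3

/-- Conjugation by any Pauli operator permutes the joint eigenprojectors. -/
theorem conj_pauliOp_mem {S : Finset (PauliLabel p n)} {R : Op p n}
    (hR : R ∈ jointEigenprojectors S) (w : PauliLabel p n) :
    pauliOp w * R * (pauliOp w)ᴴ ∈ jointEigenprojectors S := by
  obtain ⟨ψ, h, hc, rfl⟩ := hR
  refine ⟨pauliOp w *ᵥ ψ, ?_, fun v hv => ?_, ?_⟩
  · rw [star_mulVec, ← dotProduct_mulVec, mulVec_mulVec, pauliOp_conjTranspose_mul, one_mulVec, h]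
  · obtain ⟨c, hc⟩ := hc v hv
    refine ⟨ZMod.stdAddChar (sympl v w) * c, ?_⟩
    rw [mulVec_mulVec, pauliOp_mul_comm, smul_mulVec, ← mulVec_mulVec, hc, mulVec_smul, smul_smul]
  · rw [mul_vecMulVec, vecMulVec_mul, star_mulVec]

/-- Parseval's identity for the Pauli coefficients. -/
theorem trace_conjTranspose_mul_eq_sum (A B : Op p n) :
    (p : ℂ) ^ n * (Aᴴ * B).trace = ∑ v, star (coef A v) * coef B v := by
  rw [← smul_eq_mul, ← trace_smul, ← mul_smul_comm, ← sum_coef_smul_pauliOp B, Finset.mul_sum,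
    trace_sum]
  refine Finset.sum_congr rfl fun v _ => ?_
  rw [mul_smul_comm, trace_smul, smul_eq_mul, mul_comm]
  congr 1
  rw [coef, ← trace_conjTranspose, conjTranspose_mul, conjTranspose_conjTranspose]

theorem dim_ne_zero : (p : ℂ) ^ n ≠ 0 := pow_ne_zero n natCast_prime_ne_zero

/-- Distinct joint eigenprojectors of the same set are orthogonal. -/
theorem trace_mul_eq_zero {S : Finset (PauliLabel p n)} (hS : IsLagrangian S) {R R' : Op p n}
    (hR : R ∈ jointEigenprojectors S) (hR' : R' ∈ jointEigenprojectors S) (hne : R ≠ R') :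
    (R * R').trace = 0 := by
  have hex : ∃ v, coef R v ≠ coef R' v := by
    by_contra hcon
    push Not at hcon
    exact hne (op_ext hcon)
  obtain ⟨v, hv⟩ := hex
  have hvS : v = 0 ∨ v ∈ S := by
    rw [← hS.mem_perp_iff]
    by_contra hnot
    exact hv (by rw [coef_eq_zero_of_notMem_perp hR hnot, coef_eq_zero_of_notMem_perp hR' hnot])
  obtain ⟨c, hc, h1, h2⟩ := exists_pauliOp_smul hR hvS
  obtain ⟨c', hc', h1', h2'⟩ := exists_pauliOp_smul hR' hvS
  have hcc : c ≠ c' := by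
    rintro rfl
    apply hv
    have key : ∀ Q : Op p n, Q ∈ jointEigenprojectors S → pauliOp v * Q = c • Q →
        coef Q v = star c := by
      intro Q hQ hcQ
      have h5 : (pauliOp v)ᴴ * Q = star c • Q := by
        calc (pauliOp v)ᴴ * Q = (star c * c) • ((pauliOp v)ᴴ * Q) := by rw [hc, one_smul]
          _ = star c • ((pauliOp v)ᴴ * (pauliOp v * Q)) := by rw [hcQ, mul_smul_comm, smul_smul]
          _ = star c • Q := by rw [← mul_assoc, pauliOp_conjTranspose_mul, one_mul]
      rw [coef, h5, trace_smul,
        trace_of_mem_pureStates (jointEigenprojectors_subset_pureStates S hQ), smul_eq_mul, mul_one]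
    rw [key R hR h1, key R' hR' h1']
  have h3 : (R * pauliOp v) * R' = R * (pauliOp v * R') := mul_assoc _ _ _
  rw [h2, h1', smul_mul_assoc, mul_smul_comm] at h3
  have h4 := congrArg trace h3
  rw [trace_smul, trace_smul, smul_eq_mul, smul_eq_mul] at h4
  by_contra h0
  exact hcc (mul_right_cancel₀ h0 h4)

/-- The bases of a complete set of Pauli mutually unbiased bases are mutually unbiased. -/
theorem dim_mul_trace_mul (B : PauliPartition p n) {S S' : Finset (PauliLabel p n)}
    (hS : S ∈ B.parts) (hS' : S' ∈ B.parts) (hne : S ≠ S') {R R' : Op p n}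
    (hR : R ∈ jointEigenprojectors S) (hR' : R' ∈ jointEigenprojectors S') :
    (p : ℂ) ^ n * (R * R').trace = 1 := by
  have hp := jointEigenprojectors_subset_pureStates S hR
  have hp' := jointEigenprojectors_subset_pureStates S' hR'
  have h := trace_conjTranspose_mul_eq_sum R R'
  rw [conjTranspose_of_mem_pureStates hp] at h
  rw [h, Finset.sum_eq_single 0]
  · rw [coef_zero, coef_zero, trace_of_mem_pureStates hp, trace_of_mem_pureStates hp']
    simp
  · intro v _ hv
    by_cases h1 : v ∈ perp (S : Set (PauliLabel p n))
    · rw [coef_eq_zero_of_notMem_perp hR' fun h2 => hv (B.eq_zero_of_mem_perp hS hS' hne h1 h2),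
        mul_zero]
    · rw [coef_eq_zero_of_notMem_perp hR h1, star_zero, zero_mul]
  · simp

theorem PauliPartition.jointEigenprojectors_disjoint (B : PauliPartition p n)
    {S S' : Finset (PauliLabel p n)} (hS : S ∈ B.parts) (hS' : S' ∈ B.parts) {R : Op p n}
    (hR : R ∈ jointEigenprojectors S) (hR' : R ∈ jointEigenprojectors S') : S = S' := by
  by_contra hne
  have h := dim_mul_trace_mul B hS hS' hne hR hR'
  have hp := jointEigenprojectors_subset_pureStates S hR
  rw [mul_self_of_mem_pureStates hp, trace_of_mem_pureStates hp, mul_one] at h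
  have h2 := B.one_lt_dim
  have h3 : p ^ n = 1 := by exact_mod_cast h
  omega

/-- If the conjugates of an eigenprojector by a family of Pauli operators sum to a nonzero multiple
of the identity, they exhaust all eigenprojectors. -/
theorem exists_conj_eq {S : Finset (PauliLabel p n)} (hS : IsLagrangian S) {R R' : Op p n}
    (hR : R ∈ jointEigenprojectors S) (hR' : R' ∈ jointEigenprojectors S) {ι : Type*} [Fintype ι]
    (w : ι → PauliLabel p n) {c : ℂ} (hc : c ≠ 0)
    (hsum : ∑ i, pauliOp (w i) * R * (pauliOp (w i))ᴴ = c • (1 : Op p n)) :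
    ∃ i, pauliOp (w i) * R * (pauliOp (w i))ᴴ = R' := by
  by_contra hcon
  push Not at hcon
  have h1 := congrArg (fun A => (R' * A).trace) hsum
  simp only [Finset.mul_sum, trace_sum, mul_smul_comm, mul_one, trace_smul, smul_eq_mul,
    trace_of_mem_pureStates (jointEigenprojectors_subset_pureStates S hR')] at h1
  rw [Finset.sum_eq_zero] at h1
  · exact hc h1.symm
  · intro i _
    exact trace_mul_eq_zero hS hR' (conj_pauliOp_mem hR _) (hcon i).symm

theorem sum_conj_jointEigenprojector {S : Finset (PauliLabel p n)} {R : Op p n}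
    (hR : R ∈ jointEigenprojectors S) :
    ∑ w, pauliOp w * R * (pauliOp w)ᴴ = ((p : ℂ) ^ n) • (1 : Op p n) := by
  rw [sum_conj_pauliOp, trace_of_mem_pureStates (jointEigenprojectors_subset_pureStates S hR),
    mul_one]

/-- The Pauli operators act transitively on the basis of joint eigenprojectors. -/
theorem exists_conj_pauliOp_eq {S : Finset (PauliLabel p n)} (hS : IsLagrangian S) {R R' : Op p n}
    (hR : R ∈ jointEigenprojectors S) (hR' : R' ∈ jointEigenprojectors S) :
    ∃ w, pauliOp w * R * (pauliOp w)ᴴ = R' :=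
  exists_conj_eq hS hR hR' (fun w => w) dim_ne_zero (sum_conj_jointEigenprojector hR)

theorem conj_pauliOp_eq_iff {S : Finset (PauliLabel p n)} (hS : IsLagrangian S) {R : Op p n}
    (hR : R ∈ jointEigenprojectors S) (w w' : PauliLabel p n) :
    pauliOp w * R * (pauliOp w)ᴴ = pauliOp w' * R * (pauliOp w')ᴴ ↔
      w - w' ∈ perp (S : Set (PauliLabel p n)) := by
  have hsub : ∀ v, sympl w v = sympl w' v ↔ sympl (w - w') v = 0 := by
    intro v
    rw [sub_eq_add_neg, sympl_add_left, sympl_neg_left, ← sub_eq_add_neg, sub_eq_zero]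
  constructor
  · intro h v hv
    have h1 := congrArg (fun A => coef A v) h
    simp only [coef_conj_pauliOp] at h1
    have h2 := mul_right_cancel₀ (coef_ne_zero hR (Or.inr hv)) h1
    rw [sympl_swap, (hsub v).mp (ZMod.injective_stdAddChar h2), neg_zero]
  · intro h
    refine op_ext fun v => ?_
    rw [coef_conj_pauliOp, coef_conj_pauliOp]
    by_cases hv : v ∈ perp (S : Set (PauliLabel p n))
    · rw [← hS.perp_perp] at hv
      rw [(hsub v).mpr (hv _ h)]
    · rw [coef_eq_zero_of_notMem_perp hR hv, mul_zero, mul_zero]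

theorem exists_joint_eigenvector {ι V : Type*} [AddCommGroup V] [Module ℂ V]
    [FiniteDimensional ℂ V] [Nontrivial V] (f : ι → Module.End ℂ V) (S : Finset ι)
    (hf : ∀ i ∈ S, ∀ j ∈ S, Commute (f i) (f j)) :
    ∃ (μ : ι → ℂ) (v : V), v ≠ 0 ∧ ∀ i ∈ S, f i v = μ i • v := by
  induction S using Finset.induction_on with
  | empty =>
    obtain ⟨v, hv⟩ := exists_ne (0 : V)
    exact ⟨0, v, hv, by simp⟩
  | insert a S ha ih =>
    obtain ⟨μ, v, hv, hμ⟩ := ih fun i hi j hj =>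
      hf i (Finset.mem_insert_of_mem hi) j (Finset.mem_insert_of_mem hj)
    let W : Submodule ℂ V :=
      { carrier := {x | ∀ i ∈ S, f i x = μ i • x}
        zero_mem' := by simp
        add_mem' := fun {x y} hx hy i hi => by rw [map_add, hx i hi, hy i hi, smul_add]
        smul_mem' := fun c x hx i hi => by rw [map_smul, hx i hi, smul_comm] }
    have hW : ∀ x ∈ W, f a x ∈ W := by
      intro x hx i hi
      have hcomm := hf i (Finset.mem_insert_of_mem hi) a (Finset.mem_insert_self a S)
      rw [← Module.End.mul_apply, hcomm.eq, Module.End.mul_apply, hx i hi, map_smul]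
    have : Nontrivial W := ⟨⟨⟨v, hμ⟩, 0, fun h => hv (congrArg Subtype.val h)⟩⟩
    obtain ⟨c, hc⟩ := Module.End.exists_eigenvalue ((f a).restrict hW)
    obtain ⟨x, hx⟩ := hc.exists_hasEigenvector
    refine ⟨Function.update μ a c, x, fun h => hx.2 (Subtype.ext h), fun i hi => ?_⟩
    rcases Finset.mem_insert.mp hi with rfl | hi
    · have := congrArg Subtype.val hx.apply_eq_smul
      rw [Function.update_self]
      exact this
    · rw [Function.update_of_ne (ne_of_mem_of_not_mem hi ha)]
      exact x.2 i hi

theorem jointEigenprojectors_nonempty {S : Finset (PauliLabel p n)} (hS : IsLagrangian S) :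
    (jointEigenprojectors S).Nonempty := by
  obtain ⟨μ, ψ, h0, hψ⟩ := exists_joint_eigenvector (fun v : PauliLabel p n =>
    (Matrix.toLin' (pauliOp v) : Module.End ℂ ((Fin n → ZMod p) → ℂ))) S (by
      intro v hv w hw
      have hcomm := (commute_pauliOp_iff v w).mpr (hS.mem_perp hw v hv)
      change Matrix.toLin' _ * Matrix.toLin' _ = Matrix.toLin' _ * Matrix.toLin' _
      rw [Module.End.mul_eq_comp, Module.End.mul_eq_comp, ← Matrix.toLin'_mul,
        ← Matrix.toLin'_mul, hcomm.eq])
  simp only [Matrix.toLin'_apply] at hψ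
  have hpos : 0 < star ψ ⬝ᵥ ψ := dotProduct_star_self_pos_iff.mpr h0
  obtain ⟨r, hr, hrr⟩ : ∃ r : ℝ, 0 < r ∧ (r : ℂ) = star ψ ⬝ᵥ ψ := by
    obtain ⟨h1, h2⟩ := Complex.pos_iff.mp hpos
    exact ⟨_, h1, Complex.ext rfl (by simpa using h2)⟩
  let s : ℂ := ((Real.sqrt r)⁻¹ : ℝ)
  have hs : star s * s * r = 1 := by
    have : (star s : ℂ) = s := Complex.conj_ofReal _
    rw [this]
    simp only [s]
    rw [← Complex.ofReal_mul, ← Complex.ofReal_mul, ← mul_inv, Real.mul_self_sqrt hr.le,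
      inv_mul_cancel₀ hr.ne', Complex.ofReal_one]
  refine ⟨_, s • ψ, ?_, fun v hv => ⟨μ v, ?_⟩, rfl⟩
  · rw [star_smul, smul_dotProduct, dotProduct_smul, ← hrr, smul_eq_mul, smul_eq_mul, ← mul_assoc,
      hs]
  · rw [mulVec_smul, hψ v hv, smul_comm]

/-- Each set of the partition has exactly `p ^ n` joint eigenprojectors, as the Pauli operators act
transitively on them with stabilizer the set itself. -/
theorem ncard_jointEigenprojectors {S : Finset (PauliLabel p n)} (hS : IsLagrangian S) :
    (jointEigenprojectors S).ncard = p ^ n := by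
  obtain ⟨R, hR⟩ := jointEigenprojectors_nonempty hS
  set H := perp (S : Set (PauliLabel p n)) with hH
  let φ : PauliLabel p n ⧸ H → jointEigenprojectors S := fun q =>
    ⟨_, conj_pauliOp_mem hR q.out⟩
  have hφ : Function.Bijective φ := by
    constructor
    · intro q q' h
      have h1 := (conj_pauliOp_eq_iff hS hR _ _).mp (congrArg Subtype.val h)
      rw [← QuotientAddGroup.out_eq' q, ← QuotientAddGroup.out_eq' q', eq_comm,
        QuotientAddGroup.eq, neg_add_eq_sub]
      exact h1
    · rintro ⟨R', hR'⟩
      obtain ⟨w, hw⟩ := exists_conj_pauliOp_eq hS hR hR'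
      refine ⟨(w : PauliLabel p n ⧸ H), Subtype.ext ?_⟩
      change _ = R'
      rw [← hw, conj_pauliOp_eq_iff hS hR, ← neg_add_eq_sub, ← hH, ← QuotientAddGroup.eq,
        QuotientAddGroup.out_eq']
  have h1 : Nat.card (PauliLabel p n ⧸ H) = (jointEigenprojectors S).ncard :=
    Nat.card_congr (Equiv.ofBijective φ hφ)
  have h2 := H.card_eq_card_quotient_mul_card_addSubgroup
  rw [h1, hH, hS.card_perp] at h2
  have h3 : Nat.card (PauliLabel p n) = p ^ n * p ^ n := by
    simp [Nat.card_eq_fintype_card]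
  rw [h3] at h2
  exact (Nat.eq_of_mul_eq_mul_right (pow_pos (Fact.out : p.Prime).pos n) h2).symm

theorem finite_jointEigenprojectors {S : Finset (PauliLabel p n)} (hS : IsLagrangian S) :
    (jointEigenprojectors S).Finite := by
  refine Set.finite_of_ncard_pos ?_
  rw [ncard_jointEigenprojectors hS]
  exact pow_pos (Fact.out : p.Prime).pos n

/-! ### Unitaries mapping Pauli bases to Pauli bases are Clifford -/

theorem conjTranspose_mul_coe (U : UGroup p n) : (U : Op p n)ᴴ * (U : Op p n) = 1 :=
  mem_unitaryGroup_iff'.mp U.2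

theorem conjBy_mul (U : UGroup p n) (A A' : Op p n) :
    conjBy U (A * A') = conjBy U A * conjBy U A' := by
  simp only [conjBy]
  rw [show (U : Op p n) * A * (U : Op p n)ᴴ * ((U : Op p n) * A' * (U : Op p n)ᴴ) =
    (U : Op p n) * A * ((U : Op p n)ᴴ * (U : Op p n)) * A' * (U : Op p n)ᴴ by
      simp only [mul_assoc], conjTranspose_mul_coe]
  simp only [mul_assoc, one_mul]

theorem conjBy_one (U : UGroup p n) : conjBy U (1 : Op p n) = 1 := by
  rw [conjBy, mul_one]; exact mem_unitaryGroup_iff.mp U.2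

theorem conjBy_pow (U : UGroup p n) (A : Op p n) (k : ℕ) : conjBy U (A ^ k) = conjBy U A ^ k := by
  induction k with
  | zero => rw [pow_zero, pow_zero, conjBy_one]
  | succ k ih => rw [pow_succ, pow_succ, conjBy_mul, ih]

theorem conjBy_smul (U : UGroup p n) (c : ℂ) (A : Op p n) : conjBy U (c • A) = c • conjBy U A := by
  simp [conjBy]

theorem conjBy_add (U : UGroup p n) (A A' : Op p n) :
    conjBy U (A + A') = conjBy U A + conjBy U A' := by
  simp [conjBy, mul_add, add_mul]

theorem conjBy_sum (U : UGroup p n) {ι : Type*} (s : Finset ι) (A : ι → Op p n) :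
    conjBy U (∑ i ∈ s, A i) = ∑ i ∈ s, conjBy U (A i) := by
  simp [conjBy, Finset.mul_sum, Finset.sum_mul]

theorem trace_conjBy (U : UGroup p n) (A : Op p n) : (conjBy U A).trace = A.trace := by
  rw [conjBy, mul_assoc, trace_mul_comm, mul_assoc, conjTranspose_mul_coe, mul_one]

theorem conjBy_conjTranspose (U : UGroup p n) (A : Op p n) : conjBy U Aᴴ = (conjBy U A)ᴴ := by
  simp [conjBy, mul_assoc]

theorem conjBy_conjBy (U V : UGroup p n) (A : Op p n) :
    conjBy U (conjBy V A) = conjBy (U * V) A := by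
  simp [conjBy, mul_assoc]

theorem conjBy_inv_conjBy (U : UGroup p n) (A : Op p n) : conjBy U⁻¹ (conjBy U A) = A := by
  rw [conjBy_conjBy, inv_mul_cancel]; simp [conjBy]

theorem conjBy_injective (U : UGroup p n) : Function.Injective (conjBy U) :=
  Function.LeftInverse.injective (conjBy_inv_conjBy U)

/-- The conjugates of a projector of one basis by the Pauli operators in a different part resolve the
identity; with `exists_conj_eq`, these operators act transitively on that basis. -/
theorem sum_conj_perp (B : PauliPartition p n) {S S' : Finset (PauliLabel p n)}
    (hS : S ∈ B.parts) (hS' : S' ∈ B.parts) (hne : S ≠ S') {Q : Op p n}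
    (hQ : Q ∈ jointEigenprojectors S') :
    ∑ h : perp (S : Set (PauliLabel p n)),
      pauliOp (h : PauliLabel p n) * Q * (pauliOp (h : PauliLabel p n))ᴴ = 1 := by
  have hL := B.isLagrangian hS
  refine op_ext fun v => ?_
  rw [coef_twirl, hL.perp_perp, hL.card_perp, coef_one]
  by_cases h0 : v = 0
  · subst h0
    rw [if_pos (zero_mem _), if_pos rfl, coef_zero,
      trace_of_mem_pureStates (jointEigenprojectors_subset_pureStates S' hQ)]
    simp
  · rw [if_neg h0]
    by_cases h1 : v ∈ perp (S : Set (PauliLabel p n))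
    · rw [coef_eq_zero_of_notMem_perp hQ fun h2 => h0 (B.eq_zero_of_mem_perp hS hS' hne h1 h2),
        mul_zero]
    · rw [if_neg h1, zero_mul]

/-- The Pauli operators in a Lagrangian set are spanned by the joint eigenprojectors. -/
theorem commute_pauliOp_of_commute_jointEigenprojectors {S : Finset (PauliLabel p n)}
    (hS : IsLagrangian S) {V : Op p n} (hV : ∀ R ∈ jointEigenprojectors S, Commute V R)
    {v : PauliLabel p n} (hv : v ∈ perp (S : Set (PauliLabel p n))) : Commute V (pauliOp v) := by
  obtain ⟨R, hR⟩ := jointEigenprojectors_nonempty hS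
  have h1 : pauliOp v * ∑ w, pauliOp w * R * (pauliOp w)ᴴ = ((p : ℂ) ^ n) • pauliOp v := by
    rw [sum_conj_jointEigenprojector hR, mul_smul_comm, mul_one]
  have h2 : Commute V (((p : ℂ) ^ n) • pauliOp v) := by
    rw [← h1, Finset.mul_sum]
    refine Commute.sum_right _ _ _ fun w _ => ?_
    have hw := conj_pauliOp_mem hR w
    obtain ⟨c, -, hc, -⟩ := exists_pauliOp_smul hw ((hS.mem_perp_iff v).mp hv)
    rw [hc]
    exact (hV _ hw).smul_right c
  have h3 := h2.smul_right ((p : ℂ) ^ n)⁻¹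
  rwa [smul_smul, inv_mul_cancel₀ dim_ne_zero, one_smul] at h3

/-- A unitary that is diagonal in one Pauli basis and permutes a second one is a multiple of a Pauli
operator. -/
theorem exists_eq_smul_pauliOp (B : PauliPartition p n) {S S' : Finset (PauliLabel p n)}
    (hS : S ∈ B.parts) (hS' : S' ∈ B.parts) (hne : S ≠ S') {V Q : Op p n} (hVV : Vᴴ * V = 1)
    (hV : ∀ R ∈ jointEigenprojectors S, Commute V R) (hQ : Q ∈ jointEigenprojectors S')
    (hVQ : V * Q * Vᴴ ∈ jointEigenprojectors S') :
    ∃ (c : ℂ) (v : PauliLabel p n), V = c • pauliOp v := by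
  have hL := B.isLagrangian hS
  have hsum := sum_conj_perp B hS hS' hne hQ
  obtain ⟨h, hh⟩ := exists_conj_eq (B.isLagrangian hS') hQ hVQ
    (fun h : perp (S : Set (PauliLabel p n)) => (h : PauliLabel p n)) one_ne_zero
    (by rw [hsum, one_smul])
  -- `W` fixes `Q` and is still diagonal in the first basis, so it is a scalar.
  set W := (pauliOp (h : PauliLabel p n))ᴴ * V with hW
  have hVW : V = pauliOp (h : PauliLabel p n) * W := by
    rw [hW, ← mul_assoc, pauliOp_mul_conjTranspose, one_mul]
  have hWW : Wᴴ * W = 1 := by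
    rw [hW, conjTranspose_mul, conjTranspose_conjTranspose, mul_assoc,
      ← mul_assoc (pauliOp _), pauliOp_mul_conjTranspose, one_mul, hVV]
  have hWQ' : W * Q * Wᴴ = Q := by
    have : W * Q * Wᴴ =
        (pauliOp (h : PauliLabel p n))ᴴ * (V * Q * Vᴴ) * pauliOp (h : PauliLabel p n) := by
      simp only [hW, conjTranspose_mul, conjTranspose_conjTranspose, mul_assoc]
    rw [this, ← hh]
    simp only [mul_assoc, pauliOp_conjTranspose_mul, mul_one]
    rw [← mul_assoc, pauliOp_conjTranspose_mul, one_mul]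
  have hWQ : W * Q = Q * W := by
    have := congrArg (· * W) hWQ'
    simpa only [mul_assoc, hWW, mul_one] using this
  have hWT : ∀ k : perp (S : Set (PauliLabel p n)), Commute W (pauliOp (k : PauliLabel p n)) := by
    intro k
    have hVk := commute_pauliOp_of_commute_jointEigenprojectors hL hV k.2
    have hhk : Commute (pauliOp (-(h : PauliLabel p n))) (pauliOp (k : PauliLabel p n)) := by
      rw [commute_pauliOp_iff, sympl_neg_left, neg_eq_zero]
      exact hL.perp_perp.ge k.2 _ h.2
    rw [hW, pauliOp_conjTranspose]
    exact (hhk.smul_left _).mul_left hVk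
  have hQp := jointEigenprojectors_subset_pureStates S' hQ
  have hWQ2 : W * Q = (Q * W).trace • Q := by
    rw [← mul_mul_of_mem_pureStates hQp, ← hWQ, mul_assoc W, mul_self_of_mem_pureStates hQp]
  refine ⟨(Q * W).trace, h, ?_⟩
  have hWs : W = (Q * W).trace • (1 : Op p n) := by
    calc W = W * 1 := (mul_one W).symm
      _ = ∑ k : perp (S : Set (PauliLabel p n)),
          (Q * W).trace • (pauliOp (k : PauliLabel p n) * Q * (pauliOp (k : PauliLabel p n))ᴴ) := by
        rw [← hsum, Finset.mul_sum]
        refine Finset.sum_congr rfl fun k _ => ?_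
        rw [← mul_assoc, ← mul_assoc, (hWT k).eq, mul_assoc (pauliOp _) W Q, hWQ2, mul_smul_comm,
          smul_mul_assoc]
      _ = _ := by rw [← Finset.smul_sum, hsum]
  rw [hVW]
  nth_rewrite 1 [hWs]
  rw [mul_smul_comm, mul_one]

theorem pauliOp_pow (v : PauliLabel p n) (k : ℕ) :
    pauliOp v ^ k = (ZMod.stdAddChar ((k.choose 2 : ZMod p) * (v.2 ⬝ᵥ v.1)) : ℂ) •
      pauliOp (k • v) := by
  induction k with
  | zero => simp [pauliOp_zero]
  | succ k ih =>
    rw [pow_succ, ih, smul_mul_assoc, pauliOp_mul, smul_smul, ← AddChar.map_add_eq_mul,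
      succ_nsmul, Nat.choose_succ_succ' k 1, Nat.choose_one_right]
    congr 2
    rw [Prod.smul_snd, smul_dotProduct, nsmul_eq_mul]
    push_cast
    ring

theorem pauliOp_pow_phaseOrder (v : PauliLabel p n) : pauliOp v ^ phaseOrder p = 1 := by
  have h1 : ((phaseOrder p).choose 2 : ZMod p) = 0 := by
    rw [ZMod.natCast_eq_zero_iff]
    unfold phaseOrder
    split_ifs with h
    · subst h; decide
    · exact (Fact.out : p.Prime).dvd_choose_self two_ne_zero
        (lt_of_le_of_ne (Fact.out : p.Prime).two_le (Ne.symm h))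
  have h2 : phaseOrder p • v = 0 := by
    have h3 : ((phaseOrder p : ℕ) : ZMod p) = 0 := by
      rw [ZMod.natCast_eq_zero_iff]
      unfold phaseOrder
      split_ifs with h
      · subst h; decide
      · exact dvd_rfl
    ext i <;> simp [h3]
  rw [pauliOp_pow, h1, h2, zero_mul, AddChar.map_zero_eq_one, one_smul, pauliOp_zero]

theorem MapsMUB.exists_part {U : UGroup p n} {B₁ B₂ : PauliPartition p n} (h : MapsMUB U B₁ B₂)
    {S : Finset (PauliLabel p n)} (hS : S ∈ B₁.parts) :
    ∃ S' ∈ B₂.parts, conjBy U '' jointEigenprojectors S = jointEigenprojectors S' := by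
  have : conjBy U '' jointEigenprojectors S ∈ B₂.mub := by
    rw [← h]
    exact ⟨_, ⟨S, hS, rfl⟩, rfl⟩
  exact this

theorem MapsMUB.inv {U : UGroup p n} {B₁ B₂ : PauliPartition p n} (h : MapsMUB U B₁ B₂) :
    MapsMUB U⁻¹ B₂ B₁ := by
  unfold MapsMUB at h ⊢
  rw [← h, Set.image_image]
  simp only [Set.image_image, conjBy_inv_conjBy, Set.image_id']

theorem PauliPartition.exists_ne_part (B : PauliPartition p n) (S : Finset (PauliLabel p n)) :
    ∃ S' ∈ B.parts, S' ≠ S := by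
  refine Finset.exists_mem_ne ?_ S
  have := B.one_lt_dim
  rw [B.card_parts]; omega

theorem MapsMUB.conjBy_pauliOp {U : UGroup p n} {B₁ B₂ : PauliPartition p n}
    (h : MapsMUB U B₁ B₂) (v : PauliLabel p n) :
    ∃ (c : ℂ) (w : PauliLabel p n), c ^ phaseOrder p = 1 ∧ conjBy U (pauliOp v) = c • pauliOp w := by
  have hex : ∃ (c : ℂ) (w : PauliLabel p n), conjBy U (pauliOp v) = c • pauliOp w := by
    by_cases hv : v = 0
    · exact ⟨1, 0, by rw [hv, pauliOp_zero, conjBy_one, one_smul]⟩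
    obtain ⟨S, ⟨hS, hvS⟩, -⟩ := B₁.existsUnique_mem v hv
    obtain ⟨T, hT, hTS⟩ := B₁.exists_ne_part S
    obtain ⟨S', hS', hSS'⟩ := h.exists_part hS
    obtain ⟨T', hT', hTT'⟩ := h.exists_part hT
    obtain ⟨Q, hQ⟩ := jointEigenprojectors_nonempty (B₁.isLagrangian hT)
    have hne : S' ≠ T' := by
      rintro rfl
      rw [← hSS'] at hTT'
      have := (conjBy_injective U).image_injective hTT'
      rw [this] at hQ
      refine hTS (B₁.jointEigenprojectors_disjoint hT hS ?_ hQ)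
      rwa [← this] at hQ
    refine exists_eq_smul_pauliOp B₂ hS' hT' hne (V := conjBy U (pauliOp v)) (Q := conjBy U Q)
      ?_ ?_ ?_ ?_
    · rw [← conjBy_conjTranspose, ← conjBy_mul, pauliOp_conjTranspose_mul, conjBy_one]
    · intro R' hR'
      rw [← hSS'] at hR'
      obtain ⟨R, hR, rfl⟩ := hR'
      obtain ⟨c, -, h1, h2⟩ := exists_pauliOp_smul hR (Or.inr hvS)
      change _ * _ = _ * _
      rw [← conjBy_mul, ← conjBy_mul, h1, h2]
    · rw [← hTT']
      exact ⟨Q, hQ, rfl⟩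
    · rw [← conjBy_conjTranspose, ← conjBy_mul, ← conjBy_mul, ← hTT']
      exact ⟨_, conj_pauliOp_mem hQ v, rfl⟩
  obtain ⟨c, w, hc⟩ := hex
  refine ⟨c, w, ?_, hc⟩
  have h1 := congrArg (· ^ phaseOrder p) hc
  simp only [smul_pow, ← conjBy_pow, pauliOp_pow_phaseOrder, conjBy_one] at h1
  have h2 := congrFun (congrFun h1 0) 0
  simpa using h2.symm

theorem MapsMUB.conj_mem_pauliGroup {U : UGroup p n} {B₁ B₂ : PauliPartition p n}
    (h : MapsMUB U B₁ B₂) {g : UGroup p n} (hg : g ∈ pauliGroup p n) :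
    U * g * U⁻¹ ∈ pauliGroup p n := by
  obtain ⟨c, v, hc, hgv⟩ := hg
  obtain ⟨c', w, hc', hw⟩ := h.conjBy_pauliOp v
  refine ⟨c * c', w, by rw [mul_pow, hc, hc', one_mul], ?_⟩
  change conjBy U g = _
  rw [hgv, conjBy_smul, hw, smul_smul]

/-- A unitary mapping one complete set of Pauli mutually unbiased bases onto another is Clifford. -/
theorem MapsMUB.mem_cliffordGroup {U : UGroup p n} {B₁ B₂ : PauliPartition p n}
    (h : MapsMUB U B₁ B₂) : U ∈ cliffordGroup p n := by
  rw [cliffordGroup, Subgroup.mem_normalizer_iff]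
  refine fun g => ⟨fun hg => h.conj_mem_pauliGroup hg, fun hg => ?_⟩
  have := h.inv.conj_mem_pauliGroup hg
  simpa [mul_assoc] using this

/-! ### The states with non-negative Wigner functions -/

/-- The projectors onto the states of all the bases of `B`. -/
def basisProjectors (B : PauliPartition p n) : Set (Op p n) :=
  {R | ∃ S ∈ B.parts, R ∈ jointEigenprojectors S}

/-- The density matrices whose outcome probabilities, for any choice of one outcome in each basis
of `B`, add up to at least `1`. -/
def witnessedStates (B : PauliPartition p n) : Set (Op p n) :=
  {ρ | ρ.PosSemidef ∧ ρ.trace = 1 ∧ ∀ f : Finset (PauliLabel p n) → Op p n,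
    (∀ S ∈ B.parts, f S ∈ jointEigenprojectors S) → 1 ≤ ∑ S ∈ B.parts, (ρ * f S).trace.re}

/-- The measurement in one basis followed by re-preparation is the pinching of an operator to the
span of the corresponding Pauli operators. Summing over all Pauli operators `w` counts each
projector of the basis `p ^ n` times. -/
theorem coef_sum_trace_smul {S : Finset (PauliLabel p n)} (hS : IsLagrangian S) {R : Op p n}
    (hR : R ∈ jointEigenprojectors S) (ρ : Op p n) (v : PauliLabel p n) :
    coef (∑ w, (ρ * (pauliOp w * R * (pauliOp w)ᴴ)).trace • (pauliOp w * R * (pauliOp w)ᴴ)) v =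
      if v ∈ perp (S : Set (PauliLabel p n)) then (p : ℂ) ^ n * coef ρ v else 0 := by
  rw [coef_sum]
  split_ifs with hv
  · have key : ∀ w, coef ((ρ * (pauliOp w * R * (pauliOp w)ᴴ)).trace •
        (pauliOp w * R * (pauliOp w)ᴴ)) v =
        (ρ * (pauliOp v)ᴴ * (pauliOp w * R * (pauliOp w)ᴴ)).trace := by
      intro w
      have hw := conj_pauliOp_mem hR w
      set Q := pauliOp w * R * (pauliOp w)ᴴ
      obtain ⟨c, -, hc, -⟩ := exists_pauliOp_smul hw
        ((hS.mem_perp_iff (-v)).mp (neg_mem hv))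
      have h1 : (pauliOp v)ᴴ * Q = ((ZMod.stdAddChar (v.2 ⬝ᵥ v.1) : ℂ) * c) • Q := by
        rw [pauliOp_conjTranspose, smul_mul_assoc, hc, smul_smul]
      rw [coef_smul, coef, mul_assoc ρ, h1, mul_smul_comm, trace_smul, trace_smul,
        trace_of_mem_pureStates (jointEigenprojectors_subset_pureStates S hw), smul_eq_mul,
        smul_eq_mul, mul_one, mul_comm]
    rw [Finset.sum_congr rfl fun w _ => key w, ← trace_sum, ← Finset.mul_sum,
      sum_conj_jointEigenprojector hR, mul_smul_comm, mul_one, trace_smul, smul_eq_mul, coef,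
      trace_mul_comm]
  · refine Finset.sum_eq_zero fun w _ => ?_
    rw [coef_smul, coef_eq_zero_of_notMem_perp (conj_pauliOp_mem hR w) hv, mul_zero]

/-- A complete set of mutually unbiased bases is informationally complete: the outcome
probabilities in all the bases determine an operator linearly. -/
theorem sum_sum_trace_smul (B : PauliPartition p n) {R : Finset (PauliLabel p n) → Op p n}
    (hR : ∀ S ∈ B.parts, R S ∈ jointEigenprojectors S) (ρ : Op p n) :
    ∑ S ∈ B.parts, ∑ w, (ρ * (pauliOp w * R S * (pauliOp w)ᴴ)).trace •
      (pauliOp w * R S * (pauliOp w)ᴴ) = ((p : ℂ) ^ n) • (ρ + ρ.trace • (1 : Op p n)) := by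
  refine op_ext fun v => ?_
  rw [coef_sum, Finset.sum_congr rfl fun S hS =>
    coef_sum_trace_smul (B.isLagrangian hS) (hR S hS) ρ v, coef_smul, coef_add, coef_smul, coef_one]
  by_cases hv : v = 0
  · subst hv
    simp only [zero_mem, if_true, Finset.sum_const, B.card_parts, coef_zero, nsmul_eq_mul]
    push_cast
    ring
  · obtain ⟨S, ⟨hS, hvS⟩, huniq⟩ := B.existsUnique_mem v hv
    rw [if_neg hv, mul_zero, add_zero, Finset.sum_eq_single S,
      if_pos ((B.isLagrangian hS).mem_perp hvS)]
    · intro S' hS' hne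
      rw [if_neg]
      intro h
      rcases ((B.isLagrangian hS').mem_perp_iff v).mp h with h | h
      · exact hv h
      · exact hne (huniq S' ⟨hS', h⟩)
    · exact fun h => absurd hS h

theorem ofReal_re_trace_mul {A A' : Op p n} (hA : Aᴴ = A) (hA' : A'ᴴ = A') :
    ((A * A').trace.re : ℂ) = (A * A').trace := by
  refine Complex.conj_eq_iff_re.mp ?_
  have h := trace_conjTranspose (A * A')
  rw [conjTranspose_mul, hA, hA', trace_mul_comm] at h
  exact h.symm

theorem PauliPartition.exists_choice (B : PauliPartition p n) :
    ∃ R : Finset (PauliLabel p n) → Op p n, ∀ S ∈ B.parts, R S ∈ jointEigenprojectors S := by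
  have h : ∀ S : Finset (PauliLabel p n), ∃ R : Op p n,
      S ∈ B.parts → R ∈ jointEigenprojectors S := by
    intro S
    by_cases hS : S ∈ B.parts
    · obtain ⟨R, hR⟩ := jointEigenprojectors_nonempty (B.isLagrangian hS)
      exact ⟨R, fun _ => hR⟩
    · exact ⟨0, fun h => absurd h hS⟩
  choose R hR using h
  exact ⟨R, hR⟩

/-- The states satisfying all the witness inequalities are in the cone generated by the identity and
the projectors of the bases: subtract from the probabilities of each basis the smallest one. -/
theorem exists_decomposition (B : PauliPartition p n) {R : Finset (PauliLabel p n) → Op p n}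
    (hR : ∀ S ∈ B.parts, R S ∈ jointEigenprojectors S) {ρ : Op p n}
    (hρ : ρ ∈ witnessedStates B) :
    ∃ (x : ℝ) (r : Finset (PauliLabel p n) → PauliLabel p n → ℝ), 0 ≤ x ∧ (∀ S w, 0 ≤ r S w) ∧
      ρ = (x : ℂ) • (1 : Op p n) +
        ∑ S ∈ B.parts, ∑ w, (r S w : ℂ) • (pauliOp w * R S * (pauliOp w)ᴴ) := by
  obtain ⟨hpos, htr, hwit⟩ := hρ
  have hd : (0 : ℝ) < (p : ℝ) ^ n := pow_pos (Nat.cast_pos.mpr (Fact.out : p.Prime).pos) n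
  set P : Finset (PauliLabel p n) → PauliLabel p n → ℝ := fun S w =>
    (ρ * (pauliOp w * R S * (pauliOp w)ᴴ)).trace.re with hP
  have hmin : ∀ S, ∃ w₀, ∀ w, P S w₀ ≤ P S w := fun S => Finite.exists_min (P S)
  choose w₀ hw₀ using hmin
  have hm := hwit (fun S => pauliOp (w₀ S) * R S * (pauliOp (w₀ S))ᴴ)
    (fun S hS => conj_pauliOp_mem (hR S hS) _)
  refine ⟨∑ S ∈ B.parts, P S (w₀ S) - 1, fun S w => (P S w - P S (w₀ S)) / (p : ℝ) ^ n,
    sub_nonneg.mpr hm, fun S w => div_nonneg (sub_nonneg.mpr (hw₀ S w)) hd.le, ?_⟩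
  have hframe := sum_sum_trace_smul B hR ρ
  have hin : ∀ S ∈ B.parts, ∑ w, (((P S w - P S (w₀ S)) / (p : ℝ) ^ n : ℝ) : ℂ) •
      (pauliOp w * R S * (pauliOp w)ᴴ) =
      ((p : ℂ) ^ n)⁻¹ • (∑ w, (ρ * (pauliOp w * R S * (pauliOp w)ᴴ)).trace •
        (pauliOp w * R S * (pauliOp w)ᴴ)) - (P S (w₀ S) : ℂ) • (1 : Op p n) := by
    intro S hS
    have h1 : (P S (w₀ S) : ℂ) • (1 : Op p n) = ((p : ℂ) ^ n)⁻¹ • (P S (w₀ S) : ℂ) •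
        ∑ w, pauliOp w * R S * (pauliOp w)ᴴ := by
      rw [sum_conj_jointEigenprojector (hR S hS), smul_comm, smul_smul, smul_smul, mul_assoc,
        inv_mul_cancel₀ dim_ne_zero, mul_one]
    rw [h1, ← smul_sub, Finset.smul_sum, ← Finset.sum_sub_distrib, Finset.smul_sum]
    refine Finset.sum_congr rfl fun w _ => ?_
    have h2 := ofReal_re_trace_mul hpos.isHermitian.eq (conjTranspose_of_mem_pureStates
      (jointEigenprojectors_subset_pureStates S (conj_pauliOp_mem (hR S hS) w)))
    rw [← h2, ← sub_smul, smul_smul]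
    congr 1
    push_cast
    rw [div_eq_inv_mul]
  rw [Finset.sum_congr rfl hin, Finset.sum_sub_distrib, ← Finset.smul_sum, hframe, smul_smul,
    inv_mul_cancel₀ dim_ne_zero, one_smul, htr, one_smul, ← Finset.sum_smul, ← sub_eq_zero]
  push_cast
  rw [sub_smul, one_smul]
  abel

theorem sum_trace_mul_ge (B : PauliPartition p n) {Q : Op p n} (hQ : Q ∈ basisProjectors B)
    {f : Finset (PauliLabel p n) → Op p n} (hf : ∀ S ∈ B.parts, f S ∈ jointEigenprojectors S) :
    1 ≤ ∑ S ∈ B.parts, (Q * f S).trace.re := by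
  obtain ⟨S₀, hS₀, hQ⟩ := hQ
  have hd : (0 : ℝ) < (p : ℝ) ^ n := pow_pos (Nat.cast_pos.mpr (Fact.out : p.Prime).pos) n
  have h0 : 0 ≤ (Q * f S₀).trace.re := by
    by_cases h : Q = f S₀
    · have hp := jointEigenprojectors_subset_pureStates S₀ hQ
      rw [← h, mul_self_of_mem_pureStates hp, trace_of_mem_pureStates hp]
      simp
    · rw [trace_mul_eq_zero (B.isLagrangian hS₀) hQ (hf S₀ hS₀) h]
      simp
  have h1 : ∀ S ∈ B.parts.erase S₀, (Q * f S).trace.re = ((p : ℝ) ^ n)⁻¹ := by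
    intro S hS
    obtain ⟨hne, hS⟩ := Finset.mem_erase.mp hS
    have h2 := dim_mul_trace_mul B hS₀ hS (Ne.symm hne) hQ (hf S hS)
    have h3 := eq_inv_of_mul_eq_one_right h2
    rw [h3, ← Complex.ofReal_natCast, ← Complex.ofReal_pow, ← Complex.ofReal_inv,
      Complex.ofReal_re]
  rw [← Finset.add_sum_erase _ _ hS₀, Finset.sum_congr rfl h1, Finset.sum_const,
    Finset.card_erase_of_mem hS₀, B.card_parts, nsmul_eq_mul, Nat.add_sub_cancel, Nat.cast_pow,
    mul_inv_cancel₀ hd.ne']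
  linarith

theorem eq_of_trace_mul_re {R R' : Op p n} (hR : R ∈ pureStates p n) (hR' : R' ∈ pureStates p n)
    (h : 1 ≤ (R * R').trace.re) : R = R' := by
  have hh : (R - R')ᴴ = R - R' := by
    rw [conjTranspose_sub, conjTranspose_of_mem_pureStates hR, conjTranspose_of_mem_pureStates hR']
  have h1 : ((R - R')ᴴ * (R - R')).trace = 2 - 2 * (R * R').trace := by
    rw [hh, sub_mul, mul_sub, mul_sub, mul_self_of_mem_pureStates hR,
      mul_self_of_mem_pureStates hR', trace_sub, trace_sub, trace_sub, trace_mul_comm R' R,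
      trace_of_mem_pureStates hR, trace_of_mem_pureStates hR']
    ring
  have h2 := (posSemidef_conjTranspose_mul_self (R - R')).trace_nonneg
  have h3 : ((R - R')ᴴ * (R - R')).trace = 0 := by
    refine le_antisymm ?_ h2
    rw [h1] at h2 ⊢
    rw [Complex.le_def] at h2 ⊢
    obtain ⟨h4, h5⟩ := h2
    refine ⟨?_, h5.symm⟩
    simp at h4 ⊢
    linarith
  exact sub_eq_zero.mp (trace_conjTranspose_mul_self_eq_zero_iff.mp h3)

theorem basisProjectors_subset_pureStates (B : PauliPartition p n) :
    basisProjectors B ⊆ pureStates p n := by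
  rintro R ⟨S, -, hR⟩
  exact jointEigenprojectors_subset_pureStates S hR

/-- The pure states satisfying all the witness inequalities are the states of the bases: a pure
state is extreme among the density matrices. -/
theorem witnessedStates_inter_pureStates (B : PauliPartition p n) :
    witnessedStates B ∩ pureStates p n = basisProjectors B := by
  ext ρ
  constructor
  · rintro ⟨hw, hpure⟩
    obtain ⟨R, hR⟩ := B.exists_choice
    obtain ⟨x, r, hx, hr, hdec⟩ := exists_decomposition B hR hw
    by_contra hnot
    have hlt : ∀ S ∈ B.parts, ∀ w, (ρ * (pauliOp w * R S * (pauliOp w)ᴴ)).trace.re < 1 := by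
      intro S hS w
      by_contra! h
      have hmem := conj_pauliOp_mem (hR S hS) w
      have := eq_of_trace_mul_re hpure (jointEigenprojectors_subset_pureStates S hmem) h
      exact hnot ⟨S, hS, this ▸ hmem⟩
    have htr : 1 = x * (p : ℝ) ^ n + ∑ S ∈ B.parts, ∑ w, r S w := by
      have h1 := congrArg (fun A => A.trace.re) hdec
      simp only [trace_add, trace_smul, trace_sum, trace_of_mem_pureStates hpure] at h1
      rw [trace_one_op, Finset.sum_congr rfl fun S hS => Finset.sum_congr rfl fun w _ => by
        rw [trace_of_mem_pureStates (jointEigenprojectors_subset_pureStates S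
          (conj_pauliOp_mem (hR S hS) w))]] at h1
      simp only [smul_eq_mul, mul_one, Complex.add_re, Complex.re_sum, Complex.ofReal_re,
        Complex.re_ofReal_mul, Complex.one_re] at h1
      rw [h1]
      congr 2
      rw [← Complex.ofReal_natCast, ← Complex.ofReal_pow, Complex.ofReal_re]
    have hsq : 1 = x + ∑ S ∈ B.parts, ∑ w,
        r S w * (ρ * (pauliOp w * R S * (pauliOp w)ᴴ)).trace.re := by
      have h1 := congrArg (fun A => (ρ * A).trace.re) hdec
      simp only [mul_add, Finset.mul_sum, mul_smul_comm, mul_one, trace_add, trace_smul, trace_sum,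
        trace_of_mem_pureStates hpure, mul_self_of_mem_pureStates hpure, smul_eq_mul,
        Complex.add_re, Complex.re_sum, Complex.re_ofReal_mul, Complex.one_re,
        Complex.ofReal_re] at h1
      exact h1
    have hd : (1 : ℝ) < (p : ℝ) ^ n := by exact_mod_cast B.one_lt_dim
    have hle : ∀ S ∈ B.parts, ∀ w ∈ Finset.univ,
        r S w * (ρ * (pauliOp w * R S * (pauliOp w)ᴴ)).trace.re ≤ r S w := fun S hS w _ =>
      mul_le_of_le_one_right (hr S w) (hlt S hS w).le
    have hle' := Finset.sum_le_sum fun S hS => Finset.sum_le_sum (hle S hS)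
    have hx0 : x = 0 := by nlinarith
    have hex : ∃ S ∈ B.parts, ∃ w, 0 < r S w := by
      by_contra! hcon
      have : ∑ S ∈ B.parts, ∑ w, r S w ≤ 0 :=
        Finset.sum_nonpos fun S hS => Finset.sum_nonpos fun w _ => hcon S hS w
      rw [hx0] at htr
      linarith
    obtain ⟨S, hS, w, hw⟩ := hex
    have hslt : ∑ S ∈ B.parts, ∑ w, r S w * (ρ * (pauliOp w * R S * (pauliOp w)ᴴ)).trace.re <
        ∑ S ∈ B.parts, ∑ w, r S w := by
      refine Finset.sum_lt_sum (fun S hS => Finset.sum_le_sum (hle S hS)) ⟨S, hS, ?_⟩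
      exact Finset.sum_lt_sum (hle S hS) ⟨w, Finset.mem_univ w,
        mul_lt_of_lt_one_right hw (hlt S hS w)⟩
    rw [hx0] at htr hsq
    linarith
  · intro hQ
    have hpure := basisProjectors_subset_pureStates B hQ
    exact ⟨⟨posSemidef_of_mem_pureStates hpure, trace_of_mem_pureStates hpure,
      fun f hf => sum_trace_mul_ge B hQ hf⟩, hpure⟩

/-! ### Unitaries preserving the basis states -/

theorem conjBy_mem_witnessedStates (B : PauliPartition p n) {U : UGroup p n}
    (hU : Set.MapsTo (conjBy U) (basisProjectors B) (basisProjectors B)) {ρ : Op p n}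
    (hρ : ρ ∈ witnessedStates B) : conjBy U ρ ∈ witnessedStates B := by
  obtain ⟨R, hR⟩ := B.exists_choice
  obtain ⟨x, r, hx, hr, hdec⟩ := exists_decomposition B hR hρ
  have htr : (conjBy U ρ).trace = 1 := by rw [trace_conjBy, hρ.2.1]
  refine ⟨hρ.1.mul_mul_conjTranspose_same _, htr, fun f hf => ?_⟩
  set Q : Finset (PauliLabel p n) → PauliLabel p n → Op p n := fun S w =>
    conjBy U (pauliOp w * R S * (pauliOp w)ᴴ) with hQ
  have hdec' : conjBy U ρ = (x : ℂ) • (1 : Op p n) + ∑ S ∈ B.parts, ∑ w, (r S w : ℂ) • Q S w := by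
    conv_lhs => rw [hdec]
    simp only [conjBy_add, conjBy_sum, conjBy_smul, conjBy_one, hQ]
  have hQmem : ∀ S ∈ B.parts, ∀ w, Q S w ∈ basisProjectors B := fun S hS w =>
    hU ⟨S, hS, conj_pauliOp_mem (hR S hS) w⟩
  have h1 : 1 = x * (p : ℝ) ^ n + ∑ S ∈ B.parts, ∑ w, r S w := by
    have h1 := congrArg (fun A => A.trace.re) hdec'
    simp only [htr, trace_add, trace_smul, trace_sum] at h1
    rw [trace_one_op, Finset.sum_congr rfl fun S hS => Finset.sum_congr rfl fun w _ => by
      rw [trace_of_mem_pureStates (basisProjectors_subset_pureStates B (hQmem S hS w))]] at h1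
    simp only [smul_eq_mul, mul_one, Complex.add_re, Complex.re_sum, Complex.ofReal_re,
      Complex.re_ofReal_mul, Complex.one_re] at h1
    rw [h1]
    congr 2
    rw [← Complex.ofReal_natCast, ← Complex.ofReal_pow, Complex.ofReal_re]
  have h2 : ∀ S' ∈ B.parts, (conjBy U ρ * f S').trace.re =
      x + ∑ S ∈ B.parts, ∑ w, r S w * (Q S w * f S').trace.re := by
    intro S' hS'
    rw [hdec']
    simp only [add_mul, Finset.sum_mul, smul_mul_assoc, one_mul, trace_add, trace_smul, trace_sum,
      smul_eq_mul, Complex.add_re, Complex.re_sum, Complex.re_ofReal_mul,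
      trace_of_mem_pureStates (jointEigenprojectors_subset_pureStates S' (hf S' hS')),
      Complex.ofReal_re, mul_one]
  have h3 : ∑ S ∈ B.parts, ∑ w, r S w ≤
      ∑ S' ∈ B.parts, ∑ S ∈ B.parts, ∑ w, r S w * (Q S w * f S').trace.re := by
    rw [Finset.sum_comm (s := B.parts) (t := B.parts)]
    refine Finset.sum_le_sum fun S hS => ?_
    rw [Finset.sum_comm (s := B.parts)]
    refine Finset.sum_le_sum fun w _ => ?_
    rw [← Finset.mul_sum]
    exact le_mul_of_one_le_right (hr S w) (sum_trace_mul_ge B (hQmem S hS w) hf)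
  rw [Finset.sum_congr rfl h2, Finset.sum_add_distrib, Finset.sum_const, B.card_parts, nsmul_eq_mul]
  push_cast
  linarith

theorem PauliPartition.finite_mub (B : PauliPartition p n) : B.mub.Finite := by
  have : B.mub = jointEigenprojectors '' (B.parts : Set (Finset (PauliLabel p n))) := by
    ext b
    simp [PauliPartition.mub, eq_comm]
  rw [this]
  exact (Finset.finite_toSet _).image _

theorem finite_basisProjectors (B : PauliPartition p n) : (basisProjectors B).Finite := by
  have : basisProjectors B = ⋃ S ∈ B.parts, jointEigenprojectors S := by
    ext R
    simp [basisProjectors]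
  rw [this]
  exact Set.Finite.biUnion (Finset.finite_toSet _)
    fun S hS => finite_jointEigenprojectors (B.isLagrangian hS)

/-- A unitary that permutes the states of all bases permutes the bases: two states belong to the
same basis exactly if they are equal or orthogonal. -/
theorem mapsMUB_of_mapsTo (B : PauliPartition p n) {U : UGroup p n}
    (hU : Set.MapsTo (conjBy U) (basisProjectors B) (basisProjectors B)) : MapsMUB U B B := by
  have himg : ∀ S ∈ B.parts, ∃ S' ∈ B.parts,
      conjBy U '' jointEigenprojectors S = jointEigenprojectors S' := by
    intro S hS
    have hL := B.isLagrangian hS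
    obtain ⟨R₀, hR₀⟩ := jointEigenprojectors_nonempty hL
    obtain ⟨S', hS', hUR₀⟩ := hU ⟨S, hS, hR₀⟩
    have hL' := B.isLagrangian hS'
    refine ⟨S', hS', Set.eq_of_subset_of_ncard_le ?_ ?_ (finite_jointEigenprojectors hL')⟩
    · rintro _ ⟨R, hR, rfl⟩
      by_cases hRR : R₀ = R
      · rwa [← hRR]
      obtain ⟨S'', hS'', hUR⟩ := hU ⟨S, hS, hR⟩
      by_cases hSS : S' = S''
      · rwa [hSS]
      · exfalso
        have h1 := dim_mul_trace_mul B hS' hS'' hSS hUR₀ hUR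
        rw [← conjBy_mul, trace_conjBy, trace_mul_eq_zero hL hR₀ hR hRR, mul_zero] at h1
        exact zero_ne_one h1
    · rw [Set.ncard_image_of_injective _ (conjBy_injective U), ncard_jointEigenprojectors hL,
        ncard_jointEigenprojectors hL']
  refine Set.eq_of_subset_of_ncard_le ?_ ?_ B.finite_mub
  · rintro _ ⟨_, ⟨S, hS, rfl⟩, rfl⟩
    exact himg S hS
  · rw [Set.ncard_image_of_injective _ (conjBy_injective U).image_injective]

/-- The unitaries that permute the states of the bases of `B`. -/
def basisStabilizer (B : PauliPartition p n) : Subgroup (UGroup p n) where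
  carrier := {U | Set.MapsTo (conjBy U) (basisProjectors B) (basisProjectors B)}
  one_mem' := by
    intro R hR
    simpa [conjBy] using hR
  mul_mem' := by
    intro U V hU hV R hR
    rw [← conjBy_conjBy]
    exact hU (hV hR)
  inv_mem' := by
    intro U hU R hR
    obtain ⟨R', hR', rfl⟩ := ((finite_basisProjectors B).injOn_iff_bijOn_of_mapsTo hU).mp
      (conjBy_injective U).injOn |>.surjOn hR
    rwa [conjBy_inv_conjBy]

theorem formCliffordSubgroup_of_nonnegStates_eq {F : Type*} [Field F] [Fintype F]
    (B : PauliPartition p n) {𝒩 : Set (Set (F × F) → Op p n)}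
    (h𝒩 : nonnegStates 𝒩 = witnessedStates B) : FormCliffordSubgroup 𝒩 := by
  have hpure : pureNonnegPreserving 𝒩 = basisStabilizer B := by
    unfold pureNonnegPreserving
    rw [h𝒩, witnessedStates_inter_pureStates]
    rfl
  refine ⟨basisStabilizer B, fun U hU => (mapsMUB_of_mapsTo B hU).mem_cliffordGroup, ?_, hpure.symm⟩
  apply Set.Subset.antisymm
  · intro U hU ρ hρ
    rw [h𝒩] at hρ ⊢
    exact conjBy_mem_witnessedStates B hU hρ
  · intro U hU
    rw [← hpure]
    exact fun ρ hρ => ⟨hU hρ.1, unitary_conj_mem_pureStates hρ.2 U⟩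

/-! ### Lines and striations of phase space -/

section Lines

variable {F : Type*} [Field F]

/-- A normalized equation for each direction of phase space: the lines `q + m p = c` have direction
`some m`, and the lines `p = c` have direction `none`. -/
def dirForm : Option F → F × F → F
  | none, x => x.2
  | some m, x => x.1 + m * x.2

/-- The line of direction `D` on which `dirForm D` takes the value `c`. -/
def dirLine (D : Option F) (c : F) : Set (F × F) := {x | dirForm D x = c}

/-- A point on the line `dirLine D c`. -/
def dirPoint : Option F → F → F × F
  | none, c => (0, c)
  | some _, c => (c, 0)

theorem dirForm_add (D : Option F) (x y : F × F) :
    dirForm D (x + y) = dirForm D x + dirForm D y := by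
  cases D with
  | none => simp [dirForm]
  | some m => simp only [dirForm, Prod.fst_add, Prod.snd_add]; ring

theorem dirForm_sub (D : Option F) (x y : F × F) :
    dirForm D (x - y) = dirForm D x - dirForm D y := by
  rw [eq_sub_iff_add_eq, ← dirForm_add, sub_add_cancel]

@[simp] theorem dirForm_zero (D : Option F) : dirForm D 0 = 0 := by
  cases D <;> simp [dirForm]

@[simp] theorem dirForm_dirPoint (D : Option F) (c : F) : dirForm D (dirPoint D c) = c := by
  cases D <;> simp [dirForm, dirPoint]

@[simp] theorem dirPoint_zero (D : Option F) : dirPoint D 0 = 0 := by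
  cases D <;> rfl

theorem dirLine_injective :
    Function.Injective (fun x : Option F × F => dirLine x.1 x.2) := by
  rintro ⟨D, c⟩ ⟨D', c'⟩ h
  have key : ∀ x, dirForm D x = c ↔ dirForm D' x = c' := fun x => by
    change x ∈ dirLine D c ↔ x ∈ dirLine D' c'
    exact iff_of_eq (congrArg (x ∈ ·) h)
  cases D with
  | none =>
    have h1 := (key (0, c)).mp rfl
    have h2 := (key (1, c)).mp rfl
    cases D' with
    | none => simp only [dirForm] at h1; rw [h1]
    | some m' => simp [← h1, dirForm] at h2
  | some m =>
    cases D' with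
    | none =>
      have h1 := (key (0, c')).mpr rfl
      have h2 := (key (1, c')).mpr rfl
      simp [← h1, dirForm] at h2
    | some m' =>
      have h1 := (key (c, 0)).mp (by simp [dirForm])
      have h2 := (key (c - m, 1)).mp (by simp [dirForm])
      simp only [dirForm, mul_zero, add_zero, mul_one] at h1 h2
      subst h1
      have : m = m' := by linear_combination -h2
      rw [this]

theorem phaseLine_eq_dirLine {a b : F} (h : a ≠ 0 ∨ b ≠ 0) :
    ∃ (D : Option F) (k : F), k ≠ 0 ∧ ∀ c, phaseLine a b (k * c) = dirLine D c := by
  by_cases ha : a = 0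
  · have hb : b ≠ 0 := by simpa [ha] using h
    refine ⟨none, b, hb, fun c => ?_⟩
    ext x
    simp only [phaseLine, dirLine, dirForm, Set.mem_ofPred_eq, ha, zero_mul, zero_add]
    exact mul_right_inj' hb
  · refine ⟨some (b / a), a, ha, fun c => ?_⟩
    ext x
    simp only [phaseLine, dirLine, dirForm, Set.mem_ofPred_eq]
    rw [← mul_right_inj' ha (b := x.1 + b / a * x.2)]
    field_simp

theorem dirLine_eq_phaseLine (D : Option F) :
    ∃ a b : F, (a ≠ 0 ∨ b ≠ 0) ∧ ∀ c, dirLine D c = phaseLine a b c := by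
  cases D with
  | none => exact ⟨0, 1, by simp, fun c => by ext x; simp [phaseLine, dirLine, dirForm]⟩
  | some m => exact ⟨1, m, by simp, fun c => by ext x; simp [phaseLine, dirLine, dirForm]⟩

theorem mem_phaseLines_iff {l : Set (F × F)} :
    l ∈ phaseLines F ↔ ∃ D c, dirLine D c = l := by
  constructor
  · rintro ⟨a, b, c, h, rfl⟩
    obtain ⟨D, k, hk, hD⟩ := phaseLine_eq_dirLine h
    exact ⟨D, c / k, by rw [← hD, mul_div_cancel₀ _ hk]⟩
  · rintro ⟨D, c, rfl⟩
    obtain ⟨a, b, h, hab⟩ := dirLine_eq_phaseLine D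
    exact ⟨a, b, c, h, hab c⟩

theorem mem_striations_iff {s : Set (Set (F × F))} :
    s ∈ striations F ↔ ∃ D, Set.range (dirLine D) = s := by
  constructor
  · rintro ⟨a, b, h, rfl⟩
    obtain ⟨D, k, hk, hD⟩ := phaseLine_eq_dirLine h
    refine ⟨D, Set.Subset.antisymm ?_ ?_⟩
    · rintro _ ⟨c, rfl⟩
      exact ⟨k * c, hD c⟩
    · rintro _ ⟨c, rfl⟩
      exact ⟨c / k, by rw [← hD, mul_div_cancel₀ _ hk]⟩
  · rintro ⟨D, rfl⟩
    obtain ⟨a, b, h, hab⟩ := dirLine_eq_phaseLine D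
    exact ⟨a, b, h, congrArg Set.range (funext hab)⟩

theorem range_dirLine_injective :
    Function.Injective (fun D : Option F => Set.range (dirLine D)) := by
  intro D D' h
  have h1 : dirLine D 0 ∈ Set.range (dirLine D') := by
    have h2 : Set.range (dirLine D) = Set.range (dirLine D') := h
    rw [← h2]
    exact ⟨0, rfl⟩
  obtain ⟨c, hc⟩ := h1
  exact (congrArg Prod.fst (dirLine_injective (a₁ := (D', c)) (a₂ := (D, 0)) hc)).symm

theorem image_add_dirLine (D : Option F) (c : F) (α : F × F) :
    (fun x => x + α) '' dirLine D c = dirLine D (c + dirForm D α) := by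
  ext x
  constructor
  · rintro ⟨y, hy, rfl⟩
    change dirForm D (y + α) = _
    rw [dirForm_add, show dirForm D y = c from hy]
  · intro hx
    refine ⟨x - α, ?_, sub_add_cancel x α⟩
    change dirForm D (x - α) = c
    rw [dirForm_sub, show dirForm D x = c + dirForm D α from hx, add_sub_cancel_right]

theorem sum_lines_through [Fintype F] {M : Type*} [AddCommMonoid M] (N : Set (F × F) → M)
    (α : F × F) :
    ∑ l : Set (F × F) with l ∈ phaseLines F ∧ α ∈ l, N l =
      ∑ D : Option F, N (dirLine D (dirForm D α)) := by
  symm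
  refine Finset.sum_bij (fun D _ => dirLine D (dirForm D α)) ?_ ?_ ?_ fun _ _ => rfl
  · intro D _
    simp only [Finset.mem_filter, Finset.mem_univ, true_and]
    exact ⟨mem_phaseLines_iff.mpr ⟨D, _, rfl⟩, rfl⟩
  · intro D _ D' _ h
    exact congrArg Prod.fst
      (dirLine_injective (a₁ := (D, dirForm D α)) (a₂ := (D', dirForm D' α)) h)
  · intro l hl
    simp only [Finset.mem_filter, Finset.mem_univ, true_and] at hl
    obtain ⟨hl, hα⟩ := hl
    obtain ⟨D, c, rfl⟩ := mem_phaseLines_iff.mp hl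
    exact ⟨D, Finset.mem_univ D, by rw [show dirForm D α = c from hα]⟩

end Lines

/-! ### Quantum nets and their Wigner functions -/

section Nets

variable {F : Type*} [Field F]

theorem PauliPartition.jointEigenprojectors_injOn (B : PauliPartition p n)
    {S S' : Finset (PauliLabel p n)} (hS : S ∈ B.parts) (hS' : S' ∈ B.parts)
    (h : jointEigenprojectors S = jointEigenprojectors S') : S = S' := by
  obtain ⟨R, hR⟩ := jointEigenprojectors_nonempty (B.isLagrangian hS)
  exact B.jointEigenprojectors_disjoint hS hS' hR (h ▸ hR)

theorem exists_equiv_of_mem_quantumNets (B : PauliPartition p n) {N : Set (F × F) → Op p n}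
    (hN : N ∈ quantumNets F B) :
    ∃ e : Option F ≃ B.parts, ∀ D c, N (dirLine D c) ∈ jointEigenprojectors (e D).1 := by
  obtain ⟨κ, hκ, hN⟩ := hN
  have hst : ∀ D : Option F, Set.range (dirLine D) ∈ striations F := fun D =>
    mem_striations_iff.mpr ⟨D, rfl⟩
  have h1 : ∀ D : Option F, ∃ S : B.parts,
      κ (Set.range (dirLine D)) = jointEigenprojectors S.1 := fun D => by
    obtain ⟨S, hS, h⟩ := hκ.mapsTo (hst D)
    exact ⟨⟨S, hS⟩, h⟩
  choose e he using h1
  refine ⟨Equiv.ofBijective e ⟨fun D D' h => ?_, fun S => ?_⟩, fun D c => ?_⟩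
  · have h2 : κ (Set.range (dirLine D)) = κ (Set.range (dirLine D')) := by rw [he, he, h]
    exact range_dirLine_injective (hκ.injOn (hst D) (hst D') h2)
  · obtain ⟨s, hs, hsS⟩ := hκ.surjOn (show jointEigenprojectors S.1 ∈ B.mub from ⟨_, S.2, rfl⟩)
    obtain ⟨D, rfl⟩ := mem_striations_iff.mp hs
    rw [he D] at hsS
    exact ⟨D, Subtype.ext (B.jointEigenprojectors_injOn (e D).2 S.2 hsS)⟩
  · have := (hN _ (hst D)).mapsTo ⟨c, rfl⟩
    rw [he D] at this
    exact this

/-- The net with prescribed values on the lines, and value `0` off the lines. -/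
def netOf (g : Option F → F → Op p n) : Set (F × F) → Op p n :=
  Function.extend (fun x : Option F × F => dirLine x.1 x.2) (fun x => g x.1 x.2) 0

theorem netOf_dirLine (g : Option F → F → Op p n) (D : Option F) (c : F) :
    netOf g (dirLine D c) = g D c :=
  dirLine_injective.extend_apply (fun x : Option F × F => g x.1 x.2) 0 (D, c)

theorem netOf_mem_quantumNets (B : PauliPartition p n) (e : Option F ≃ B.parts)
    {g : Option F → F → Op p n}
    (hg : ∀ D, Set.BijOn (g D) Set.univ (jointEigenprojectors (e D).1)) :
    netOf g ∈ quantumNets F B := by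
  set κ : Set (Set (F × F)) → Set (Op p n) := Function.extend
    (fun D : Option F => Set.range (dirLine D)) (fun D => jointEigenprojectors (e D).1)
    (fun _ => ∅) with hκ
  have hκD : ∀ D : Option F, κ (Set.range (dirLine D)) = jointEigenprojectors (e D).1 := fun D =>
    range_dirLine_injective.extend_apply _ _ D
  refine ⟨κ, ⟨?_, ?_, ?_⟩, ?_⟩
  · intro s hs
    obtain ⟨D, rfl⟩ := mem_striations_iff.mp hs
    rw [hκD]
    exact ⟨_, (e D).2, rfl⟩
  · intro s hs s' hs' h
    obtain ⟨D, rfl⟩ := mem_striations_iff.mp hs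
    obtain ⟨D', rfl⟩ := mem_striations_iff.mp hs'
    rw [hκD, hκD] at h
    rw [e.injective (Subtype.ext (B.jointEigenprojectors_injOn (e D).2 (e D').2 h))]
  · rintro _ ⟨S, hS, rfl⟩
    obtain ⟨D, hD⟩ := e.surjective ⟨S, hS⟩
    exact ⟨_, mem_striations_iff.mpr ⟨D, rfl⟩, by rw [hκD, hD]⟩
  · intro s hs
    obtain ⟨D, rfl⟩ := mem_striations_iff.mp hs
    rw [hκD]
    refine ⟨?_, ?_, ?_⟩
    · rintro _ ⟨c, rfl⟩
      rw [netOf_dirLine]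
      exact (hg D).mapsTo (Set.mem_univ c)
    · rintro _ ⟨c, rfl⟩ _ ⟨c', rfl⟩ h
      rw [netOf_dirLine, netOf_dirLine] at h
      rw [(hg D).injOn (Set.mem_univ c) (Set.mem_univ c') h]
    · intro R hR
      obtain ⟨c, -, hc⟩ := (hg D).surjOn hR
      exact ⟨_, ⟨c, rfl⟩, by rw [netOf_dirLine, hc]⟩

variable [Fintype F]

theorem wigner_nonneg_iff (N : Set (F × F) → Op p n) {ρ : Op p n} (hρ : ρ.trace = 1)
    (α : F × F) :
    0 ≤ wigner N ρ α ↔ 1 ≤ ∑ D, (ρ * N (dirLine D (dirForm D α))).trace.re := by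
  have hd : (0 : ℝ) < 1 / (p : ℝ) ^ n :=
    one_div_pos.mpr (pow_pos (Nat.cast_pos.mpr (Fact.out : p.Prime).pos) n)
  have h1 : wigner N ρ α =
      1 / (p : ℝ) ^ n * (∑ D, (ρ * N (dirLine D (dirForm D α))).trace.re - 1) := by
    have h2 : (1 / (p : ℂ) ^ n) = ((1 / (p : ℝ) ^ n : ℝ) : ℂ) := by push_cast; rfl
    rw [wigner, pointOp, sum_lines_through, mul_smul_comm, trace_smul, mul_sub, mul_one, trace_sub,
      hρ, Finset.mul_sum, trace_sum, smul_eq_mul, h2, Complex.re_ofReal_mul, Complex.sub_re,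
      Complex.re_sum, Complex.one_re]
  rw [h1, mul_nonneg_iff_of_pos_left hd, sub_nonneg]

theorem sum_parts_eq (B : PauliPartition p n) (e : Option F ≃ B.parts)
    (g : Finset (PauliLabel p n) → ℝ) : ∑ S ∈ B.parts, g S = ∑ D, g (e D).1 := by
  rw [← Finset.sum_coe_sort, ← e.sum_comp]

/-- If the values of the nets on the lines through the origin are arbitrary choices of one projector
from each basis, then non-negativity for all nets amounts to all the witness inequalities. -/
theorem nonnegStates_eq_witnessedStates (B : PauliPartition p n)
    {𝒩 : Set (Set (F × F) → Op p n)} (hsub : 𝒩 ⊆ quantumNets F B)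
    (hex : ∀ f : Finset (PauliLabel p n) → Op p n,
      (∀ S ∈ B.parts, f S ∈ jointEigenprojectors S) →
      ∃ N ∈ 𝒩, ∃ e : Option F ≃ B.parts, ∀ D, N (dirLine D 0) = f (e D).1) :
    nonnegStates 𝒩 = witnessedStates B := by
  ext ρ
  constructor
  · rintro ⟨hpos, htr, hnn⟩
    refine ⟨hpos, htr, fun f hf => ?_⟩
    obtain ⟨N, hN, e, he⟩ := hex f hf
    have h := (wigner_nonneg_iff N htr 0).mp (hnn N hN 0)
    rw [sum_parts_eq B e]
    simpa [he] using h
  · rintro ⟨hpos, htr, hwit⟩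
    refine ⟨hpos, htr, fun N hN α => ?_⟩
    rw [wigner_nonneg_iff N htr]
    obtain ⟨e, he⟩ := exists_equiv_of_mem_quantumNets B (hsub hN)
    have h := hwit (fun S => if hS : S ∈ B.parts then
        N (dirLine (e.symm ⟨S, hS⟩) (dirForm (e.symm ⟨S, hS⟩) α)) else 0) (by
      intro S hS
      rw [dif_pos hS]
      have := he (e.symm ⟨S, hS⟩) (dirForm (e.symm ⟨S, hS⟩) α)
      rwa [Equiv.apply_symm_apply] at this)
    rw [sum_parts_eq B e] at h
    simpa using h

theorem nonnegStates_quantumNets (B : PauliPartition p n) (hF : Fintype.card F = p ^ n) :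
    nonnegStates (quantumNets F B) = witnessedStates B := by
  refine nonnegStates_eq_witnessedStates B subset_rfl fun f hf => ?_
  have e : Option F ≃ B.parts := Fintype.equivOfCardEq (by
    rw [Fintype.card_option, hF, Fintype.card_coe, B.card_parts])
  have hg : ∀ D, ∃ g : F → Op p n, Set.BijOn g Set.univ (jointEigenprojectors (e D).1) ∧
      g 0 = f (e D).1 := by
    intro D
    have hL := B.isLagrangian (e D).2
    have : Finite (jointEigenprojectors (e D).1) := finite_jointEigenprojectors hL
    have hcard : Nat.card F = Nat.card (jointEigenprojectors (e D).1) := by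
      rw [Nat.card_eq_fintype_card, hF]
      exact (ncard_jointEigenprojectors hL).symm
    have u : F ≃ jointEigenprojectors (e D).1 := (Finite.card_eq.mp hcard).some
    let u' := u.trans (Equiv.swap (u 0) ⟨f (e D).1, hf _ (e D).2⟩)
    refine ⟨fun c => (u' c).1, ⟨fun c _ => (u' c).2, fun c _ c' _ h => u'.injective (Subtype.ext h),
      fun R hR => ⟨u'.symm ⟨R, hR⟩, trivial, by simp⟩⟩, ?_⟩
    simp [u']
  choose g hg h0 using hg
  exact ⟨netOf g, netOf_mem_quantumNets B e hg, e, fun D => by rw [netOf_dirLine, h0]⟩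

/-- An adapted labelling matches the directions of phase space with the sets of the partition. -/
theorem IsAdapted.exists_equiv (B : PauliPartition p n) (hF : Fintype.card F = p ^ n)
    {L : F × F ≃+ PauliLabel p n} (hL : IsAdapted B L) :
    ∃ e : Option F ≃ B.parts, ∀ D α,
      L α ∈ perp ((e D).1 : Set (PauliLabel p n)) ↔ dirForm D α = 0 := by
  have h1 : ∀ D : Option F, ∃ S : B.parts,
      ((S : Finset (PauliLabel p n)) : Set (PauliLabel p n)) = L '' (dirLine D 0 \ {0}) := by
    intro D
    obtain ⟨a, b, h, hab⟩ := dirLine_eq_phaseLine D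
    obtain ⟨S, hS, h2⟩ := hL a b h
    exact ⟨⟨S, hS⟩, by rw [hab]; exact h2⟩
  choose e he using h1
  have hperp : ∀ D α, L α ∈ perp ((e D).1 : Set (PauliLabel p n)) ↔ dirForm D α = 0 := by
    intro D α
    rw [(B.isLagrangian (e D).2).mem_perp_iff, ← Finset.mem_coe, he D]
    by_cases hα : α = 0
    · simp [hα]
    · have hLα : L α ≠ 0 := by simpa using hα
      simp only [hLα, false_or]
      constructor
      · rintro ⟨β, hβ, h⟩
        rw [← L.injective h]
        exact hβ.1
      · intro h
        exact ⟨α, ⟨h, hα⟩, rfl⟩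
  have hinj : Function.Injective e := by
    intro D D' h
    have : dirLine D 0 = dirLine D' 0 := by
      ext α
      change dirForm D α = 0 ↔ dirForm D' α = 0
      rw [← hperp, ← hperp, h]
    exact congrArg Prod.fst (dirLine_injective (a₁ := (D, 0)) (a₂ := (D', 0)) this)
  have hbij : Function.Bijective e := (Fintype.bijective_iff_injective_and_card e).mpr ⟨hinj, by
    rw [Fintype.card_option, hF, Fintype.card_coe, B.card_parts]⟩
  exact ⟨Equiv.ofBijective e hbij, hperp⟩

/-- A covariant net is determined by its values on the lines through the origin, and these can be
prescribed: the projector on a translated line is the conjugate by the corresponding Pauli operator,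
and translations along a line fix its projector. -/
theorem nonnegStates_covariantNets (B : PauliPartition p n) (hF : Fintype.card F = p ^ n)
    {L : F × F ≃+ PauliLabel p n} (hL : IsAdapted B L) :
    nonnegStates (covariantNets B L) = witnessedStates B := by
  refine nonnegStates_eq_witnessedStates B (fun N hN => hN.1) fun f hf => ?_
  obtain ⟨e, he⟩ := hL.exists_equiv B hF
  set g : Option F → F → Op p n := fun D c =>
    pauliOp (L (dirPoint D c)) * f (e D).1 * (pauliOp (L (dirPoint D c)))ᴴ with hg
  have hconj : ∀ D α β, pauliOp (L α) * f (e D).1 * (pauliOp (L α))ᴴ =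
      pauliOp (L β) * f (e D).1 * (pauliOp (L β))ᴴ ↔ dirForm D α = dirForm D β := by
    intro D α β
    rw [conj_pauliOp_eq_iff (B.isLagrangian (e D).2) (hf _ (e D).2), ← map_sub, he, dirForm_sub,
      sub_eq_zero]
  refine ⟨netOf g, ⟨netOf_mem_quantumNets B e fun D => ⟨fun c _ => ?_, fun c _ c' _ h => ?_,
    fun R hR => ?_⟩, fun l hl α => ?_⟩, e, fun D => ?_⟩
  · exact conj_pauliOp_mem (hf _ (e D).2) _
  · have := (hconj D _ _).mp h
    rwa [dirForm_dirPoint, dirForm_dirPoint] at this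
  · obtain ⟨w, hw⟩ := exists_conj_pauliOp_eq (B.isLagrangian (e D).2) (hf _ (e D).2) hR
    refine ⟨dirForm D (L.symm w), trivial, ?_⟩
    rw [← hw, ← L.apply_symm_apply w, hg]
    simp only
    rw [hconj, dirForm_dirPoint, L.symm_apply_apply]
  · obtain ⟨D, c, rfl⟩ := mem_phaseLines_iff.mp hl
    rw [image_add_dirLine, netOf_dirLine, netOf_dirLine, hg]
    simp only
    have h1 : pauliOp (L α) * (pauliOp (L (dirPoint D c)) * f (e D).1 *
        (pauliOp (L (dirPoint D c)))ᴴ) * (pauliOp (L α))ᴴ =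
        pauliOp (L (α + dirPoint D c)) * f (e D).1 * (pauliOp (L (α + dirPoint D c)))ᴴ := by
      refine op_ext fun v => ?_
      rw [coef_conj_pauliOp, coef_conj_pauliOp, coef_conj_pauliOp, ← mul_assoc,
        ← AddChar.map_add_eq_mul, ← sympl_add_left, map_add]
    rw [h1, hconj, dirForm_add, dirForm_dirPoint, dirForm_dirPoint, add_comm]
  · rw [netOf_dirLine, hg]
    simp [pauliOp_zero]

end Nets

end DiscreteWigner

end

theorem theorem2 (p n : ℕ) [Fact p.Prime] :
    (∀ (B₁ B₂ : DiscreteWigner.PauliPartition p n) (U : DiscreteWigner.UGroup p n),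
      DiscreteWigner.MapsMUB U B₁ B₂ →
      ∃ (c : ℂ) (C : DiscreteWigner.UGroup p n), ‖c‖ = 1 ∧ C ∈ DiscreteWigner.cliffordGroup p n ∧
        (U : DiscreteWigner.Op p n) = c • (C : DiscreteWigner.Op p n)) ∧
    (∀ (B : DiscreteWigner.PauliPartition p n) (F : Type*) [Field F] [Fintype F],
      Fintype.card F = p ^ n →
      DiscreteWigner.FormCliffordSubgroup (DiscreteWigner.quantumNets F B) ∧
      ∀ L : F × F ≃+ DiscreteWigner.PauliLabel p n, DiscreteWigner.IsAdapted B L →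
        DiscreteWigner.FormCliffordSubgroup (DiscreteWigner.covariantNets B L)) := by
  -- The Clifford group contains all global phases, so `c = 1` serves.
  refine ⟨fun B₁ B₂ U hU => ⟨1, U, norm_one, hU.mem_cliffordGroup, (one_smul _ _).symm⟩, ?_⟩
  intro B F _ _ hF
  exact ⟨DiscreteWigner.formCliffordSubgroup_of_nonnegStates_eq B
      (DiscreteWigner.nonnegStates_quantumNets B hF), fun L hL =>
    DiscreteWigner.formCliffordSubgroup_of_nonnegStates_eq B
      (DiscreteWigner.nonnegStates_covariantNets B hF hL)⟩
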